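/- A convex polytope is the convex hull of a finite nonempty set of points in a finite-dimensional real vector space; its face poset consists of its nonempty faces (including the polytope itself) ordered by inclusion, and its facets are its faces of codimension one. Let $A(N)$ be the poset of sets of pairwise noncrossing diagonals of a convex $N$-gon. Let $B(n)$ be the poset of sets of pairwise noncrossing diagonals of a convex centrally symmetric $2n$-gon, where a diagonal now means a pair of centrally symmetric diagonals or a diameter. Let $C(n)$ be the analogous poset for the centrally symmetric $2n$-gon with a central vertex, where a diagonal means: the circle around the central vertex; a pair of centrally symmetric diagonals, including, for $n\ge 2$ and every two antipodal vertices, the pair of diameters joining them on the two sides of the central vertex; or, for every two antipodal vertices, the single diameter joining them through the central vertex. Here the circle crosses exactly the single diameters, two single diameters never cross, and a pair crosses another pair or a single diameter exactly when the straight chords with the same ends cross in their interiors (distinct chords whose four ends are distinct and alternate around the polygon). In all three posets $a\preceq a'$ if $a$ is obtained from $a'$ by adding diagonals. The associahedron $K_n$ ($n\ge 2$), the cyclohedron $W_n$ ($n\ge 1$) and the halohedron $H_n$ ($n\ge 1$) are convex polytopes of dimension $n-2$, $n-1$ and $n$ whose face posets are isomorphic to $A(n+1)$, $B(n)$ and $C(n)$,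 respectively; a "copy" of a polytope is a polytope with an isomorphic face poset. Proposition. For every $n\ge 1$, the facets of the halohedron $H_n$ (of every convex polytope that realizes it) are, listed without repetition: (1) one copy of the cyclohedron $W_n$; (2) $n$ copies of the associahedron $K_{n+1}$; (3) for each $m$ with $2\le m\le n$, $n$ copies of the product $K_m\times H_{n-m+1}$, hence $n^2-n$ such facets in total. -/

import Mathlib

/-! ### Convex polytopes and their face posets -/

/-- A convex polytope: the convex hull of a finite nonempty set of points. -/
def IsPolytope {E : Type*} [AddCommGroup E] [Module ℝ E] (P : Set E) : Prop :=
  ∃ S : Set E, S.Finite ∧ S.Nonempty ∧ P = convexHull ℝ S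

/-- The dimension of a (nonempty) convex set: the dimension of its affine span. -/
noncomputable def polyDim {E : Type*} [AddCommGroup E] [Module ℝ E] (P : Set E) : ℕ :=
  Module.finrank ℝ (vectorSpan ℝ P)

/-- The face poset of `P`, ordered by inclusion. A face is the nonempty set of points of `P` at
which some linear functional attains its maximum over `P`; in particular `P` itself is a face,
and the empty set is not. -/
abbrev Face {E : Type*} [NormedAddCommGroup E] [NormedSpace ℝ E] (P : Set E) : Type _ :=
  {F : Set E // IsExposed ℝ P F ∧ F.Nonempty}

/-- The facets of `P`: the faces of codimension one. -/
abbrev Facet {E : Type*} [NormedAddCommGroup E] [NormedSpace ℝ E] (P : Set E) : Type _ :=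
  {F : Set E // IsExposed ℝ P F ∧ F.Nonempty ∧ polyDim F + 1 = polyDim P}

/-- Two polytopes are combinatorially equivalent if their face posets are isomorphic. -/
def CombEquiv {E E' : Type*} [NormedAddCommGroup E] [NormedSpace ℝ E]
    [NormedAddCommGroup E'] [NormedSpace ℝ E'] (P : Set E) (Q : Set E') : Prop :=
  Nonempty (Face P ≃o Face Q)

/-! ### Diagonals of polygons

The vertices of a convex polygon with `N` sides are labelled by `Fin N` in cyclic order, and a
chord is an unordered pair of vertices. -/

/-- A diagonal of the convex `N`-gon: a chord joining two distinct vertices that are not the two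
ends of a side. -/
def IsDiagonal {N : ℕ} (e : Sym2 (Fin N)) : Prop :=
  ∃ a b : Fin N, e = s(a, b) ∧ (a : ℕ) + 2 ≤ b ∧ (b : ℕ) + 2 ≤ a + N

/-- Two chords of a convex polygon cross if they meet in their interiors and are distinct: their
four ends are distinct and alternate around the polygon. -/
def Crosses {N : ℕ} (e f : Sym2 (Fin N)) : Prop :=
  ∃ a b c d : Fin N, a < c ∧ c < b ∧ b < d ∧
    ((e = s(a, b) ∧ f = s(c, d)) ∨ (e = s(c, d) ∧ f = s(a, b)))

/-- The antipodal vertex in the centrally symmetric `2n`-gon. -/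
def antipode {n : ℕ} (i : Fin (2 * n)) : Fin (2 * n) :=
  ⟨(i + n) % (2 * n), Nat.mod_lt _ (Nat.lt_of_le_of_lt (Nat.zero_le _) i.isLt)⟩

/-- For a set of "diagonals" `α` with a relation "do not cross", the poset of diagonalizations:
sets of pairwise noncrossing diagonals, where adding diagonals makes an element smaller
(the order is reverse inclusion). -/
abbrev Diagonalizations {α : Type*} (noncrossing : α → α → Prop) : Type _ :=
  {U : Set α // U.Pairwise noncrossing}ᵒᵈ

/-- The poset `A(N)` of diagonalizations of the convex `N`-gon. -/
abbrev PosetA (N : ℕ) : Type :=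
  Diagonalizations fun e f : {e : Sym2 (Fin N) // IsDiagonal e} => ¬ Crosses e.1 f.1

/-- A symmetric diagonal of the centrally symmetric `2n`-gon: a diagonal together with its image
under the central symmetry. It is a pair of centrally symmetric diagonals, or a diameter (when the
two coincide). -/
abbrev SymDiagonal (n : ℕ) : Type :=
  {D : Set (Sym2 (Fin (2 * n))) //
    ∃ d : Sym2 (Fin (2 * n)), IsDiagonal d ∧ D = {d, d.map antipode}}

/-- No chord of `D` crosses a chord of `D'`. -/
def NonCrossing {N : ℕ} (D D' : Set (Sym2 (Fin N))) : Prop :=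
  ∀ d ∈ D, ∀ d' ∈ D', ¬ Crosses d d'

/-- The poset `B(n)` of diagonalizations of the centrally symmetric `2n`-gon. -/
abbrev PosetB (n : ℕ) : Type :=
  Diagonalizations fun D D' : SymDiagonal n => NonCrossing D.1 D'.1

/-- The diagonals of the centrally symmetric `2n`-gon with a central vertex:
* the circle around the central vertex;
* pairs of centrally symmetric diagonals, neither of which passes through the central vertex.
  Besides the pairs of two different straight diagonals there is, for every straight diameter
  that is a diagonal, the pair of (bent) diameters with the same two ends, which pass the central
  vertex on its two sides;
* for every two antipodal vertices, the single diameter that joins them through the central vertex.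
-/
inductive CentralDiagonal (n : ℕ) : Type
  | circle : CentralDiagonal n
  | pair (D : SymDiagonal n) : CentralDiagonal n
  | diameter (e : {e : Sym2 (Fin (2 * n)) // ∃ i, e = s(i, antipode i)}) : CentralDiagonal n

/-- When two diagonals of the `2n`-gon with a central vertex do not cross. The circle crosses the
single diameters only; two single diameters meet only in the central vertex, so they do not cross;
a pair crosses a pair or a single diameter when the straight chords with the same ends cross. (For
the pair of diameters with ends `i, antipode i` this means: it crosses the pairs of diameters and
the single diameters at all other antipodal vertices, but not the single diameter between its own
ends.) -/
def CentralDiagonal.NonCrossing {n : ℕ} : CentralDiagonal n → CentralDiagonal n → Prop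
  | .circle, .circle => True
  | .circle, .pair _ => True
  | .circle, .diameter _ => False
  | .pair _, .circle => True
  | .pair D, .pair D' => _root_.NonCrossing D.1 D'.1
  | .pair D, .diameter e => _root_.NonCrossing D.1 {e.1}
  | .diameter _, .circle => False
  | .diameter e, .pair D => _root_.NonCrossing {e.1} D.1
  | .diameter _, .diameter _ => True

/-- The poset `C(n)` of diagonalizations of the centrally symmetric `2n`-gon with a central
vertex. -/
abbrev PosetC (n : ℕ) : Type :=
  Diagonalizations (CentralDiagonal.NonCrossing (n := n))

/-! ### Associahedra, cyclohedra, halohedra -/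

/-- `P` is (a realization of) the associahedron `K_n`, `n ≥ 2`: a convex polytope of dimension
`n - 2` whose face poset is isomorphic to `A(n + 1)`. -/
def IsAssociahedron {E : Type*} [NormedAddCommGroup E] [NormedSpace ℝ E]
    (n : ℕ) (P : Set E) : Prop :=
  IsPolytope P ∧ polyDim P + 2 = n ∧ Nonempty (Face P ≃o PosetA (n + 1))

/-- `P` is (a realization of) the cyclohedron `W_n`, `n ≥ 1`: a convex polytope of dimension
`n - 1` whose face poset is isomorphic to `B(n)`. -/
def IsCyclohedron {E : Type*} [NormedAddCommGroup E] [NormedSpace ℝ E]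
    (n : ℕ) (P : Set E) : Prop :=
  IsPolytope P ∧ polyDim P + 1 = n ∧ Nonempty (Face P ≃o PosetB n)

/-- `P` is (a realization of) the halohedron `H_n`, `n ≥ 1`: a convex polytope of dimension `n`
whose face poset is isomorphic to `C(n)`. -/
def IsHalohedron {E : Type*} [NormedAddCommGroup E] [NormedSpace ℝ E]
    (n : ℕ) (P : Set E) : Prop :=
  IsPolytope P ∧ polyDim P = n ∧ Nonempty (Face P ≃o PosetC n)

/-! ### Faces of convex polytopes -/

section Polytope

variable {E : Type*} [NormedAddCommGroup E] [NormedSpace ℝ E]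

/-! The argument has a geometric half and a combinatorial half.

Geometry: the dimension of a face can be read off from the face poset. A covering relation between
faces of a polytope raises the dimension by exactly one (`IsPolytope.polyDim_covBy`). Adding one
diagonal is a covering relation, so under any isomorphism with a poset of diagonalizations the
codimension of a face is its number of diagonals (`IsPolytope.polyDim_add_ncard`). Hence facets
correspond to single diagonals (`IsPolytope.exists_facetEquiv`). The faces of the facet of `D` are
the diagonalizations that contain `D`, that is, the sets of pairwise noncrossing diagonals
compatible with `D`. If these split into two families that never cross each other, this poset is a
product (`exists_linkIso`), and both factors are realized by faces of the facet itself
(`IsPolytope.exists_prod_face_single`).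

Combinatorics: cut the polygon along `D`. The circle is compatible with exactly the pairs, which
gives `B(n)`. A single diameter leaves half of the polygon together with the central vertex, an `(n
+ 2)`-gon (`mem_range_ofDiameterLink`). A pair that cuts off `m` sides on each side leaves two
symmetric `(m + 1)`-gons, which count once, and a central `2(n - m + 1)`-gon (`mem_range_pairLink`).
Labelling vertices by integers turns the half turn into translation by `n`; one representative per
orbit gives `n` diameters and `n` pairs for each `m` (`ofIndex_bijective`). -/

theorem vectorSpan_le_ker_iff {Q : Set E} (l : E →ₗ[ℝ] ℝ) :
    vectorSpan ℝ Q ≤ LinearMap.ker l ↔ ∀ x ∈ Q, ∀ y ∈ Q, l x = l y := by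
  rw [vectorSpan_def, Submodule.span_le]
  constructor
  · intro h x hx y hy
    have := h (Set.vsub_mem_vsub hx hy)
    simpa [sub_eq_zero] using this
  · rintro h _ ⟨x, hx, y, hy, rfl⟩
    simp [h x hx y hy]

theorem IsPolytope.isCompact {P : Set E} (hP : IsPolytope P) : IsCompact P := by
  obtain ⟨S, hS, -, rfl⟩ := hP
  exact hS.isCompact_convexHull ℝ

/-- By Krein–Milman a face is the closed hull of its extreme points; these are extreme in the whole
polytope and therefore lie in `S`. -/
theorem IsExposed.eq_convexHull_inter {S F : Set E} (hS : S.Finite)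
    (hF : IsExposed ℝ (convexHull ℝ S) F) : F = convexHull ℝ (S ∩ F) := by
  have hc : Convex ℝ F := hF.convex (convex_convexHull ℝ S)
  apply Set.Subset.antisymm
  · have hk : IsCompact F := hF.isCompact (hS.isCompact_convexHull ℝ)
    have hsub : Set.extremePoints ℝ F ⊆ S ∩ F := fun x hx =>
      ⟨extremePoints_convexHull_subset (hF.isExtreme.extremePoints_subset_extremePoints hx), hx.1⟩
    calc F = closure (convexHull ℝ (Set.extremePoints ℝ F)) :=
          (closure_convexHull_extremePoints hk hc).symm
      _ ⊆ closure (convexHull ℝ (S ∩ F)) := closure_mono (convexHull_mono hsub)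
      _ = convexHull ℝ (S ∩ F) :=
          ((hS.inter_of_left F).isCompact_convexHull ℝ).isClosed.closure_eq
  · exact convexHull_min Set.inter_subset_right hc

theorem IsPolytope.of_isExposed {P F : Set E} (hP : IsPolytope P) (hF : IsExposed ℝ P F)
    (hne : F.Nonempty) : IsPolytope F := by
  obtain ⟨S, hS, -, rfl⟩ := hP
  refine ⟨S ∩ F, hS.inter_of_left F, ?_, hF.eq_convexHull_inter hS⟩
  rw [← convexHull_nonempty_iff (𝕜 := ℝ), ← hF.eq_convexHull_inter hS]
  exact hne

theorem le_of_mem_convexHull {S : Set E} (l : StrongDual ℝ E) {c : ℝ} (h : ∀ s ∈ S, l s ≤ c)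
    {x : E} (hx : x ∈ convexHull ℝ S) : l x ≤ c :=
  convexHull_min (t := {x | l x ≤ c}) h (convex_halfSpace_le l.isLinear c) hx

/-- A functional whose values at the points of `S` are at most its value at `x₀` exposes the face
of all points where it agrees with `x₀`. -/
theorem isExposed_of_forall_le {S : Set E} (l : StrongDual ℝ E) {x₀ : E}
    (hx₀ : x₀ ∈ convexHull ℝ S) (h : ∀ s ∈ S, l s ≤ l x₀) :
    IsExposed ℝ (convexHull ℝ S) {x ∈ convexHull ℝ S | l x = l x₀} := by
  intro _
  refine ⟨l, Set.ext fun x => and_congr_right fun hx => ?_⟩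
  constructor
  · intro he y hy
    rw [he]
    exact le_of_mem_convexHull l h hy
  · intro hm
    exact le_antisymm (le_of_mem_convexHull l h hx) (hm _ hx₀)

theorem IsExposed.exists_eq {P F : Set E} (hF : IsExposed ℝ P F) {x₀ : E} (hx₀ : x₀ ∈ F) :
    ∃ l : StrongDual ℝ E, (∀ y ∈ P, l y ≤ l x₀) ∧ F = {x ∈ P | l x = l x₀} := by
  obtain ⟨l, hl⟩ := hF ⟨x₀, hx₀⟩
  have h0 : ∀ y ∈ P, l y ≤ l x₀ := by
    rw [hl] at hx₀
    exact hx₀.2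
  refine ⟨l, h0, ?_⟩
  nth_rewrite 1 [hl]
  ext x
  refine and_congr_right fun hx => ⟨fun h => le_antisymm (h0 x hx) (h _ (hF.subset hx₀)), ?_⟩
  intro h y hy
  rw [h]
  exact h0 y hy

/-- A face of a face of a polytope is a face of the polytope. -/
theorem IsPolytope.isExposed_trans {P F G : Set E} (hP : IsPolytope P) (hF : IsExposed ℝ P F)
    (hG : IsExposed ℝ F G) : IsExposed ℝ P G := by
  rcases G.eq_empty_or_nonempty with rfl | ⟨x₀, hx₀⟩
  · exact isExposed_empty
  obtain ⟨S, hS, -, rfl⟩ := hP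
  have hx₀F := hG.subset hx₀
  have hx₀P := hF.subset hx₀F
  obtain ⟨l₁, h₁, hF'⟩ := hF.exists_eq hx₀F
  obtain ⟨l₂, h₂, hG'⟩ := hG.exists_eq hx₀
  -- With `K` this large, `K • l₁ + l₂` penalizes the finitely many points of `S` off `F` so
  -- strongly that its maximum is attained inside `F`, where `l₂` decides.
  obtain ⟨K, hK⟩ : ∃ K : ℝ, ∀ s ∈ S, s ∉ F → l₂ s - l₂ x₀ < K * (l₁ x₀ - l₁ s) := by
    obtain ⟨K, hK⟩ := (hS.image fun s => (l₂ s - l₂ x₀) / (l₁ x₀ - l₁ s)).bddAbove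
    refine ⟨K + 1, fun s hs hsF => ?_⟩
    have hsP := subset_convexHull ℝ S hs
    have hpos : 0 < l₁ x₀ - l₁ s := by
      refine sub_pos.2 (lt_of_le_of_ne (h₁ s hsP) fun he => hsF ?_)
      rw [hF']
      exact ⟨hsP, he⟩
    have := hK ⟨s, hs, rfl⟩
    rw [← div_lt_iff₀ hpos]
    exact lt_of_le_of_lt this (lt_add_one K)
  have heqF : ∀ x ∈ F, l₁ x = l₁ x₀ := fun x hx => by
    rw [hF'] at hx
    exact hx.2
  have heqG : ∀ x ∈ G, l₂ x = l₂ x₀ := fun x hx => by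
    rw [hG'] at hx
    exact hx.2
  have hle : ∀ s ∈ S, (K • l₁ + l₂) s ≤ (K • l₁ + l₂) x₀ := by
    intro s hs
    simp only [add_apply, smul_apply, smul_eq_mul]
    by_cases hsF : s ∈ F
    · rw [heqF s hsF]
      linarith [h₂ s hsF]
    · linarith [hK s hs hsF]
  have hex := isExposed_of_forall_le (K • l₁ + l₂) hx₀P hle
  convert hex using 1
  apply Set.Subset.antisymm
  · intro x hx
    have hxF := hG.subset hx
    refine ⟨hF.subset hxF, ?_⟩
    simp [heqF x hxF, heqG x hx]
  · rw [hex.eq_convexHull_inter hS]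
    refine convexHull_min ?_ (hG.convex (hF.convex (convex_convexHull ℝ S)))
    rintro s ⟨hs, -, he⟩
    simp only [add_apply, smul_apply, smul_eq_mul] at he
    have hsF : s ∈ F := by
      by_contra hsF
      linarith [hK s hs hsF]
    rw [hG']
    refine ⟨hsF, ?_⟩
    rw [heqF s hsF] at he
    linarith

theorem IsPolytope.isExposed_iff {P F G : Set E} (hP : IsPolytope P) (hF : IsExposed ℝ P F) :
    IsExposed ℝ F G ↔ IsExposed ℝ P G ∧ G ⊆ F :=
  ⟨fun h => ⟨hP.isExposed_trans hF h, h.subset⟩, fun h => h.1.mono hF.subset h.2⟩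

/-- The faces of a face `F` of a polytope are the faces below `F`. -/
def IsPolytope.faceIso {P : Set E} (hP : IsPolytope P) (F : Face P) :
    Face F.1 ≃o Set.Iic F where
  toFun G := ⟨⟨G.1, hP.isExposed_trans F.2.1 G.2.1, G.2.2⟩, G.2.1.subset⟩
  invFun G := ⟨G.1.1, (hP.isExposed_iff F.2.1).2 ⟨G.1.2.1, G.2⟩, G.1.2.2⟩
  left_inv _ := rfl
  right_inv _ := rfl
  map_rel_iff' := Iff.rfl

theorem IsPolytope.nonempty {P : Set E} (hP : IsPolytope P) : P.Nonempty := by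
  obtain ⟨S, -, hS, rfl⟩ := hP
  exact hS.convexHull

variable [FiniteDimensional ℝ E]

theorem IsExposed.polyDim_lt {Q F : Set E} (hF : IsExposed ℝ Q F) (hne : F.Nonempty)
    (h : F ≠ Q) : polyDim F < polyDim Q := by
  obtain ⟨x₀, hx₀⟩ := hne
  obtain ⟨l, -, hF'⟩ := hF.exists_eq hx₀
  apply Submodule.finrank_lt_finrank_of_lt
  refine lt_of_le_of_ne (vectorSpan_mono ℝ hF.subset) fun he => h ?_
  have hker : vectorSpan ℝ F ≤ LinearMap.ker (l : E →ₗ[ℝ] ℝ) := by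
    rw [vectorSpan_le_ker_iff, hF']
    rintro x hx y hy
    exact hx.2.trans hy.2.symm
  rw [he, vectorSpan_le_ker_iff] at hker
  rw [hF']
  ext x
  exact ⟨fun hx => hx.1, fun hx => ⟨hx, hker x hx x₀ (hF.subset hx₀)⟩⟩

/-- A functional that is nonzero on some direction of `Q` is not constant on `Q`, so its set of
maximizers is a proper face. -/
theorem IsPolytope.exists_isExposed_ne {Q : Set E} (hQ : IsPolytope Q) (h : polyDim Q ≠ 0) :
    ∃ F, IsExposed ℝ Q F ∧ F.Nonempty ∧ F ≠ Q := by
  have hbot : vectorSpan ℝ Q ≠ ⊥ := fun hb => h (by rw [polyDim, hb, finrank_bot])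
  obtain ⟨u, hu, hu0⟩ := Submodule.exists_mem_ne_zero_of_ne_bot hbot
  obtain ⟨f, hf, -⟩ := Submodule.exists_le_ker_of_notMem (p := (⊥ : Submodule ℝ E)) (v := u)
    (by simpa using hu0)
  have hlu : LinearMap.toContinuousLinearMap f u ≠ 0 := hf
  generalize LinearMap.toContinuousLinearMap f = l at hlu
  obtain ⟨x₀, hx₀, hm⟩ := hQ.isCompact.exists_isMaxOn hQ.nonempty l.continuous.continuousOn
  refine ⟨l.toExposed Q, ContinuousLinearMap.toExposed.isExposed, ⟨x₀, hx₀, hm⟩, fun he => hlu ?_⟩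
  have hker : vectorSpan ℝ Q ≤ LinearMap.ker (l : E →ₗ[ℝ] ℝ) := by
    rw [vectorSpan_le_ker_iff]
    intro x hx y hy
    rw [← he] at hx hy
    exact le_antisymm (hy.2 x hx.1) (hx.2 y hy.1)
  exact hker hu

/-- The supporting hyperplane of `F` is rotated about `F` until it touches another point of `S`. The
codimension leaves room to do so without the hyperplane swallowing all of `Q`. -/
theorem IsPolytope.exists_isExposed_between {Q F : Set E} (hQ : IsPolytope Q)
    (hF : IsExposed ℝ Q F) (hne : F.Nonempty) (h : polyDim F + 1 < polyDim Q) :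
    ∃ H, IsExposed ℝ Q H ∧ F ⊂ H ∧ H ⊂ Q := by
  obtain ⟨x₀, hx₀⟩ := hne
  have hx₀Q := hF.subset hx₀
  obtain ⟨l, hl, hF'⟩ := hF.exists_eq hx₀
  obtain ⟨S, hS, -, rfl⟩ := hQ
  set V := vectorSpan ℝ (convexHull ℝ S) with hV
  -- `V ⊓ ker l` has codimension at most one in `V`, so it is too large to lie in the direction
  -- space of `F`.
  obtain ⟨u, ⟨huV, hlu⟩, huF⟩ : ∃ u ∈ V ⊓ LinearMap.ker (l : E →ₗ[ℝ] ℝ), u ∉ vectorSpan ℝ F := by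
    by_contra! hc
    have h1 : Module.finrank ℝ ↥(V ⊓ LinearMap.ker (l : E →ₗ[ℝ] ℝ)) ≤
      Module.finrank ℝ (vectorSpan ℝ F) := Submodule.finrank_mono hc
    have h2 := Submodule.finrank_sup_add_finrank_inf_eq V (LinearMap.ker (l : E →ₗ[ℝ] ℝ))
    have h3 := (l : E →ₗ[ℝ] ℝ).finrank_range_add_finrank_ker
    have h4 := (LinearMap.range (l : E →ₗ[ℝ] ℝ)).finrank_le
    have h5 := (V ⊔ LinearMap.ker (l : E →ₗ[ℝ] ℝ)).finrank_le
    rw [Module.finrank_self] at h4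
    unfold polyDim at h
    rw [← hV] at h
    omega
  obtain ⟨f, hfu, hfF⟩ := Submodule.exists_le_ker_of_notMem huF
  rw [vectorSpan_le_ker_iff] at hfF
  -- `f` is not constant on `S`, since `u ∈ V` and `f u ≠ 0`; the sign of `l' = ±f` is chosen so
  -- that it increases from `F` to some point of `S`.
  obtain ⟨l', hl'u, hl'F, s₁, hs₁, hs₁'⟩ : ∃ l' : StrongDual ℝ E, l' u ≠ 0 ∧
      (∀ x ∈ F, l' x = l' x₀) ∧ ∃ s ∈ S, l' x₀ < l' s := by
    have key : ∃ s ∈ S, f s ≠ f x₀ := by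
      by_contra! hc
      have hsub : S ⊆ {x | f x = f x₀} := hc
      have hconv : Convex ℝ {x | f x = f x₀} := convex_hyperplane f.isLinear _
      have hall := convexHull_min hsub hconv
      have : V ≤ LinearMap.ker f := (vectorSpan_le_ker_iff f).2 fun x hx y hy =>
        (hall hx).trans (hall hy).symm
      exact hfu (this huV)
    obtain ⟨s, hs, hne⟩ := key
    rcases lt_or_gt_of_ne hne with hlt | hgt
    · refine ⟨LinearMap.toContinuousLinearMap (-f), ?_, fun x hx => ?_, s, hs, ?_⟩
      · simpa using hfu
      · simp [hfF x hx x₀ hx₀]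
      · simpa using hlt
    · exact ⟨LinearMap.toContinuousLinearMap f, hfu, fun x hx => hfF x hx x₀ hx₀, s, hs, hgt⟩
  have hlt : ∀ s ∈ S, l' x₀ < l' s → l s < l x₀ := by
    intro s hs hlt
    have hsQ := subset_convexHull ℝ S hs
    refine lt_of_le_of_ne (hl s hsQ) fun he => ?_
    have hsF : s ∈ F := by
      rw [hF']
      exact ⟨hsQ, he⟩
    exact hlt.ne' (hl'F s hsF)
  -- The minimal ratio is the first `t` at which `l + t • l'` takes at a point of `S` off `F` with
  -- larger `l'` the same value as on `F`.
  obtain ⟨s₂, ⟨hs₂, hs₂'⟩, hmin⟩ := (hS.subset (Set.sep_subset S fun s => l' x₀ < l' s)).exists_minimalFor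
    (fun s => (l x₀ - l s) / (l' s - l' x₀)) _ ⟨s₁, hs₁, hs₁'⟩
  have hpos₂ : 0 < l' s₂ - l' x₀ := sub_pos.2 hs₂'
  set t := (l x₀ - l s₂) / (l' s₂ - l' x₀) with ht
  have htpos : 0 < t := div_pos (sub_pos.2 (hlt s₂ hs₂ hs₂')) hpos₂
  have hle : ∀ s ∈ S, (l + t • l') s ≤ (l + t • l') x₀ := by
    intro s hs
    simp only [add_apply, smul_apply, smul_eq_mul]
    by_cases hs' : l' x₀ < l' s
    · have hts : t ≤ (l x₀ - l s) / (l' s - l' x₀) := by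
        by_contra! hc
        exact absurd (hmin ⟨hs, hs'⟩ hc.le) (not_le.2 hc)
      rw [le_div_iff₀ (sub_pos.2 hs')] at hts
      linarith
    · have := hl s (subset_convexHull ℝ S hs)
      nlinarith
  refine ⟨_, isExposed_of_forall_le (l + t • l') hx₀Q hle, ⟨fun x hx => ⟨hF.subset hx, ?_⟩, ?_⟩,
    Set.sep_subset _ _, ?_⟩
  · have hlx : l x = l x₀ := by
      rw [hF'] at hx
      exact hx.2
    simp [hlx, hl'F x hx]
  · intro hsub
    refine hs₂'.ne' (hl'F s₂ (hsub ⟨subset_convexHull ℝ S hs₂, ?_⟩))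
    have : t * (l' s₂ - l' x₀) = l x₀ - l s₂ := div_mul_cancel₀ _ hpos₂.ne'
    simp only [add_apply, smul_apply, smul_eq_mul]
    linarith
  · intro hsub
    -- If the new face were all of `Q`, then `l + t • l'` would vanish at `u`; but `l u = 0`, `t >
    -- 0` and `l' u ≠ 0`.
    have : V ≤ LinearMap.ker ((l + t • l' : StrongDual ℝ E) : E →ₗ[ℝ] ℝ) :=
      (vectorSpan_le_ker_iff _).2 fun x hx y hy => (hsub hx).2.trans (hsub hy).2.symm
    have h0 : l u + t * l' u = 0 := this huV
    have hlu' : l u = 0 := hlu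
    rw [hlu', zero_add] at h0
    exact mul_ne_zero htpos.ne' hl'u h0

/-- A gap of two or more would leave room for an intermediate face. -/
theorem IsPolytope.polyDim_covBy {P : Set E} (hP : IsPolytope P) {F G : Face P} (h : F ⋖ G) :
    polyDim F.1 + 1 = polyDim G.1 := by
  have hG := hP.of_isExposed G.2.1 G.2.2
  have hFG : IsExposed ℝ G.1 F.1 := (hP.isExposed_iff G.2.1).2 ⟨F.2.1, h.1.le⟩
  have hlt := hFG.polyDim_lt F.2.2 fun he => h.1.ne (Subtype.ext he)
  by_contra hne
  obtain ⟨H, hH, hFH, hHG⟩ := hG.exists_isExposed_between hFG F.2.2 (by omega)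
  exact h.2 (c := ⟨H, hP.isExposed_trans G.2.1 hH, F.2.2.mono hFH.1⟩) hFH hHG

theorem IsPolytope.polyDim_eq_zero_of_isMin {P : Set E} (hP : IsPolytope P) {F : Face P}
    (h : IsMin F) : polyDim F.1 = 0 := by
  by_contra hne
  obtain ⟨G, hG, hGne, hGF⟩ := (hP.of_isExposed F.2.1 F.2.2).exists_isExposed_ne hne
  have hle : (⟨G, hP.isExposed_trans F.2.1 hG, hGne⟩ : Face P) ≤ F := hG.subset
  exact hGF (Set.Subset.antisymm hle (h hle))

end Polytope

/-! ### Faces of products. -/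

section Product

variable {E E' : Type*} [NormedAddCommGroup E] [NormedSpace ℝ E]
  [NormedAddCommGroup E'] [NormedSpace ℝ E']

theorem IsExposed.prod {A F : Set E} {B G : Set E'} (hF : IsExposed ℝ A F) (hG : IsExposed ℝ B G) :
    IsExposed ℝ (A ×ˢ B) (F ×ˢ G) := by
  rintro ⟨⟨x₀, y₀⟩, hx₀, hy₀⟩
  obtain ⟨l₁, h₁⟩ := hF ⟨x₀, hx₀⟩
  obtain ⟨l₂, h₂⟩ := hG ⟨y₀, hy₀⟩
  have hx₀A := hF.subset hx₀
  have hy₀B := hG.subset hy₀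
  refine ⟨l₁.comp (ContinuousLinearMap.fst ℝ E E') + l₂.comp (ContinuousLinearMap.snd ℝ E E'), ?_⟩
  rw [h₁] at hx₀
  rw [h₂] at hy₀
  ext ⟨x, y⟩
  simp only [h₁, h₂, Set.mem_prod, Set.mem_ofPred_eq, Prod.forall, add_apply,
    ContinuousLinearMap.comp_apply, ContinuousLinearMap.coe_fst', ContinuousLinearMap.coe_snd']
  constructor
  · rintro ⟨⟨hx, hx'⟩, hy, hy'⟩
    exact ⟨⟨hx, hy⟩, fun a b hab => add_le_add (hx' a hab.1) (hy' b hab.2)⟩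
  · rintro ⟨⟨hx, hy⟩, h⟩
    refine ⟨⟨hx, fun a ha => ?_⟩, hy, fun b hb => ?_⟩
    · linarith [h a y ⟨ha, hy⟩]
    · linarith [h x b ⟨hx, hb⟩]

/-- A functional on a product is a sum of functionals of the two coordinates, which are maximized
independently. -/
theorem IsExposed.exists_eq_prod {A : Set E} {B : Set E'} {H : Set (E × E')}
    (hH : IsExposed ℝ (A ×ˢ B) H) (hne : H.Nonempty) :
    ∃ F G, IsExposed ℝ A F ∧ IsExposed ℝ B G ∧ H = F ×ˢ G := by
  obtain ⟨l, hl⟩ := hH hne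
  refine ⟨_, _, ContinuousLinearMap.toExposed.isExposed
    (l := l.comp (ContinuousLinearMap.inl ℝ E E')), ContinuousLinearMap.toExposed.isExposed
    (l := l.comp (ContinuousLinearMap.inr ℝ E E')), ?_⟩
  have hadd : ∀ x y, l (x, y) = l (x, 0) + l (0, y) := fun x y => by
    rw [← map_add]
    simp
  rw [hl]
  ext ⟨x, y⟩
  simp only [Set.mem_prod, Set.mem_ofPred_eq, Prod.forall, ContinuousLinearMap.toExposed,
    ContinuousLinearMap.comp_apply, ContinuousLinearMap.inl_apply, ContinuousLinearMap.inr_apply]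
  constructor
  · rintro ⟨⟨hx, hy⟩, h⟩
    refine ⟨⟨hx, fun a ha => ?_⟩, hy, fun b hb => ?_⟩
    · have := h a y ⟨ha, hy⟩
      rw [hadd, hadd x] at this
      linarith
    · have := h x b ⟨hx, hb⟩
      rw [hadd, hadd x y] at this
      linarith
  · rintro ⟨⟨hx, hx'⟩, hy, hy'⟩
    refine ⟨⟨hx, hy⟩, fun a b hab => ?_⟩
    rw [hadd, hadd x]
    exact add_le_add (hx' a hab.1) (hy' b hab.2)

/-- The face poset of a product is the product of the face posets. -/
theorem nonempty_faceProdIso (A : Set E) (B : Set E') :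
    Nonempty (Face A × Face B ≃o Face (A ×ˢ B)) := by
  let f : Face A × Face B ↪o Face (A ×ˢ B) := OrderEmbedding.ofMapLEIff
    (fun p => ⟨p.1.1 ×ˢ p.2.1, p.1.2.1.prod p.2.2.1, p.1.2.2.prod p.2.2.2⟩) fun p q => by
      change p.1.1 ×ˢ p.2.1 ⊆ q.1.1 ×ˢ q.2.1 ↔ p.1.1 ⊆ q.1.1 ∧ p.2.1 ⊆ q.2.1
      rw [Set.prod_subset_prod_iff]
      simp [p.1.2.2.ne_empty, p.2.2.2.ne_empty]
  refine ⟨RelIso.ofSurjective f ?_⟩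
  rintro ⟨H, hH, hne⟩
  obtain ⟨F, G, hF, hG, rfl⟩ := hH.exists_eq_prod hne
  exact ⟨(⟨F, hF, hne.fst⟩, ⟨G, hG, hne.snd⟩), rfl⟩

end Product

/-! ### Posets of diagonalizations -/

section OrderLemmas

variable {α β γ : Type*}

/-- An order isomorphism restricts to principal lower sets. -/
def OrderIso.iicCongr [Preorder α] [Preorder β] (e : α ≃o β) (a : α) :
    Set.Iic a ≃o Set.Iic (e a) where
  toFun x := ⟨e x.1, e.monotone x.2⟩
  invFun y := ⟨e.symm y.1, (e.symm_apply_le).2 y.2⟩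
  left_inv x := by simp
  right_inv y := by simp
  map_rel_iff' := e.le_iff_le

/-- The part of a product below `(⊤, c)` with `c` minimal is the first factor. -/
def OrderIso.iicTopMin [PartialOrder α] [PartialOrder β] {a : α} {c : β} (ha : IsTop a)
    (hc : IsMin c) : α ≃o Set.Iic (a, c) where
  toFun x := ⟨(x, c), ha x, le_rfl⟩
  invFun x := x.1.1
  left_inv _ := rfl
  right_inv x := Subtype.ext (Prod.ext rfl (hc.eq_of_le x.2.2).symm)
  map_rel_iff' := by
    intro x y
    exact ⟨fun h => h.1, fun h => ⟨h, le_rfl⟩⟩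

/-- The part of a product below `(c, ⊤)` with `c` minimal is the second factor. -/
def OrderIso.iicMinTop [PartialOrder α] [PartialOrder β] {a : α} {c : β} (ha : IsTop a)
    (hc : IsMin c) : α ≃o Set.Iic (c, a) where
  toFun x := ⟨(c, x), le_rfl, ha x⟩
  invFun x := x.1.2
  left_inv _ := rfl
  right_inv x := Subtype.ext (Prod.ext (hc.eq_of_le x.2.1).symm rfl)
  map_rel_iff' := by
    intro x y
    exact ⟨fun h => h.2, fun h => ⟨le_rfl, h⟩⟩

end OrderLemmas

namespace Diagonalizations

variable {α β γ : Type*} {r : α → α → Prop} {s : β → β → Prop} {t : γ → γ → Prop}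

/-- The set of diagonals of a diagonalization. -/
def diagonals (U : Diagonalizations r) : Set α := (OrderDual.ofDual U).1

/-- The diagonalization with a given set of diagonals. -/
def mk (r : α → α → Prop) (T : Set α) (hT : T.Pairwise r) : Diagonalizations r :=
  OrderDual.toDual ⟨T, hT⟩

theorem le_iff {U V : Diagonalizations r} : U ≤ V ↔ V.diagonals ⊆ U.diagonals := Iff.rfl

theorem pairwise (U : Diagonalizations r) : U.diagonals.Pairwise r := (OrderDual.ofDual U).2

theorem diagonals_mk (T : Set α) (hT : T.Pairwise r) : (mk r T hT).diagonals = T := rfl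

theorem diagonals_injective : Function.Injective (diagonals (r := r)) :=
  fun _ _ h => le_antisymm (le_iff.2 h.ge) (le_iff.2 h.le)

/-- The diagonalization that consists of a single diagonal. -/
def single (r : α → α → Prop) (D : α) : Diagonalizations r := mk r {D} (Set.pairwise_singleton D r)

/-- The diagonalization without diagonals. -/
def empty (r : α → α → Prop) : Diagonalizations r := mk r ∅ (Set.pairwise_empty r)

theorem isTop_empty : IsTop (empty r) := fun U => le_iff.2 (Set.empty_subset U.diagonals)

theorem mk_insert_covBy {a : α} {T : Set α} (ha : a ∉ T) (h : (insert a T).Pairwise r) :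
    mk r (insert a T) h ⋖ mk r T (h.mono (Set.subset_insert a T)) := by
  refine ⟨⟨Set.subset_insert a T, fun hle => ha (hle (Set.mem_insert a T))⟩, ?_⟩
  intro V h1 h2
  have h1' : V.diagonals ⊆ insert a T := h1.1
  by_cases haV : a ∈ V.diagonals
  · exact h1.2 (Set.insert_subset haV h2.1)
  · exact h2.2 ((Set.subset_insert_iff_of_notMem haV).1 h1')

theorem exists_isMin [Finite α] : ∃ U : Diagonalizations r, IsMin U := by
  have : Finite (Diagonalizations r) := Finite.of_injective _ diagonals_injective
  obtain ⟨U, hU⟩ := (Set.finite_univ (α := Diagonalizations r)).exists_minimal ⟨empty r, trivial⟩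
  exact ⟨U, fun V hV => hU.2 trivial hV⟩

/-- If `f` and `g` jointly enumerate the diagonals that are compatible with and different from `D`,
the diagonalizations that contain `D` are pairs of diagonalizations. -/
theorem exists_linkIso {D : α} {f : β → α} {g : γ → α} (hr : ∀ x y, r x y → r y x)
    (hinj : Function.Injective (Sum.elim f g))
    (hrange : ∀ x, x ∈ Set.range (Sum.elim f g) ↔ x ≠ D ∧ r D x)
    (hf : ∀ x y, s x y ↔ r (f x) (f y)) (hg : ∀ x y, t x y ↔ r (g x) (g y))
    (hfg : ∀ x y, r (f x) (g y)) :
    ∃ e : Diagonalizations s × Diagonalizations t ≃o Set.Iic (single r D),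
      ∀ V, (e V).1.diagonals = insert D (Sum.elim f g '' (Sum.inl '' V.1.diagonals ∪
        Sum.inr '' V.2.diagonals)) := by
  have hD : ∀ x, Sum.elim f g x ≠ D ∧ r D (Sum.elim f g x) := fun x => (hrange _).1 ⟨x, rfl⟩
  have hpair : ∀ V : Diagonalizations s × Diagonalizations t,
      (insert D (Sum.elim f g '' (Sum.inl '' V.1.diagonals ∪ Sum.inr '' V.2.diagonals))).Pairwise
        r := by
    intro V
    rw [Set.pairwise_insert]
    constructor
    · rintro _ ⟨x, hx, rfl⟩ _ ⟨y, hy, rfl⟩ hne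
      rcases hx with ⟨x, hx, rfl⟩ | ⟨x, hx, rfl⟩ <;> rcases hy with ⟨y, hy, rfl⟩ | ⟨y, hy, rfl⟩
      · exact (hf x y).1 (V.1.pairwise hx hy fun h => hne (by rw [h]))
      · exact hfg x y
      · exact hr _ _ (hfg y x)
      · exact (hg x y).1 (V.2.pairwise hx hy fun h => hne (by rw [h]))
    · rintro _ ⟨x, hx, rfl⟩ -
      exact ⟨(hD x).2, hr _ _ (hD x).2⟩
  let φ : Diagonalizations s × Diagonalizations t ↪o Set.Iic (single r D) :=
    OrderEmbedding.ofMapLEIff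
      (fun V => ⟨mk r _ (hpair V), le_iff.2 (Set.singleton_subset_iff.2 (Set.mem_insert D _))⟩) <| by
    intro V W
    change (insert D _ : Set α) ⊆ insert D _ ↔ W.1.diagonals ⊆ V.1.diagonals ∧ W.2.diagonals ⊆ V.2.diagonals
    have hn : ∀ T, D ∉ Sum.elim f g '' T := by
      rintro T ⟨x, -, hx⟩
      exact (hD x).1 hx
    rw [Set.insert_subset_insert_iff (hn _), Set.image_subset_image_iff hinj]
    constructor
    · intro h
      refine ⟨fun x hx => ?_, fun x hx => ?_⟩
      · simpa using h (Or.inl ⟨x, hx, rfl⟩)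
      · simpa using h (Or.inr ⟨x, hx, rfl⟩)
    · intro h
      exact Set.union_subset_union (Set.image_mono h.1) (Set.image_mono h.2)
  refine ⟨RelIso.ofSurjective φ ?_, fun V => rfl⟩
  -- Every other diagonal of `U` is compatible with `D`, hence is a value of `f` or of `g`; the
  -- preimages of `U` recover the two factors.
  rintro ⟨U, hU⟩
  have hDU : D ∈ U.diagonals := hU rfl
  refine ⟨(mk s (f ⁻¹' U.diagonals) ?_, mk t (g ⁻¹' U.diagonals) ?_), ?_⟩
  · rintro x hx y hy hne
    exact (hf x y).2 (U.pairwise hx hy fun h => hne (Sum.inl_injective (hinj h)))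
  · rintro x hx y hy hne
    exact (hg x y).2 (U.pairwise hx hy fun h => hne (Sum.inr_injective (hinj h)))
  · apply Subtype.ext
    apply diagonals_injective
    change insert D (Sum.elim f g '' _) = _
    ext x
    constructor
    · rintro (rfl | ⟨_, ⟨y, hy, rfl⟩ | ⟨y, hy, rfl⟩, rfl⟩)
      · exact hDU
      · exact hy
      · exact hy
    · intro hx
      by_cases hxD : x = D
      · exact Or.inl hxD
      · obtain ⟨y, rfl⟩ := (hrange x).2 ⟨hxD, U.pairwise hDU hx fun h => hxD h.symm⟩
        refine Or.inr ⟨y, ?_, rfl⟩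
        rcases y with y | y
        · exact Or.inl ⟨y, hx, rfl⟩
        · exact Or.inr ⟨y, hx, rfl⟩

end Diagonalizations

/-! ### Polytopes whose face poset is a poset of diagonalizations. -/

section Realization

open Diagonalizations

variable {E : Type*} [NormedAddCommGroup E] [NormedSpace ℝ E]
  {α β γ : Type*} {r : α → α → Prop} {s : β → β → Prop} {t : γ → γ → Prop} {P : Set E}

/-- The faces of the face that corresponds to a single diagonal. -/
def IsPolytope.faceSingleIso (hP : IsPolytope P) (Φ : Face P ≃o Diagonalizations r) (D : α) :
    Face (Φ.symm (single r D)).1 ≃o Set.Iic (single r D) :=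
  (hP.faceIso _).trans (Φ.symm.iicCongr (single r D)).symm

/-- The case of `exists_linkIso` in which the second family is empty, so that its poset is a single
point. -/
theorem IsPolytope.nonempty_face_single_iso (hP : IsPolytope P)
    (Φ : Face P ≃o Diagonalizations r) {D : α} {f : β → α} (hr : ∀ x y, r x y → r y x)
    (hinj : Function.Injective f) (hrange : ∀ x, x ∈ Set.range f ↔ x ≠ D ∧ r D x)
    (hf : ∀ x y, s x y ↔ r (f x) (f y)) :
    Nonempty (Face (Φ.symm (single r D)).1 ≃o Diagonalizations s) := by
  obtain ⟨e, -⟩ := exists_linkIso (s := s) (t := fun _ _ : PEmpty.{1} => True) (D := D) (f := f)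
    (g := PEmpty.elim) hr
    (Function.Injective.sumElim hinj (fun x => x.elim) fun _ y => y.elim)
    (fun x => by
      rw [← hrange x, Set.mem_range, Set.mem_range]
      constructor
      · rintro ⟨y | y, rfl⟩
        · exact ⟨y, rfl⟩
        · exact y.elim
      · rintro ⟨y, rfl⟩
        exact ⟨Sum.inl y, rfl⟩)
    hf (fun x => x.elim) (fun _ y => y.elim)
  let e' : Diagonalizations s ≃o Diagonalizations s × Diagonalizations fun _ _ : PEmpty.{1} => True :=
    { toFun := fun U => (U, empty _)
      invFun := fun p => p.1
      left_inv := fun _ => rfl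
      right_inv := fun p => Prod.ext rfl (diagonals_injective (Set.ext fun x => x.elim))
      map_rel_iff' := fun {U V} => ⟨fun h => h.1, fun h => ⟨h, le_rfl⟩⟩ }
  exact ⟨((hP.faceSingleIso Φ D).trans e.symm).trans e'.symm⟩

variable [FiniteDimensional ℝ E]

/-- Inserting the diagonals one at a time, starting from the whole polytope, each step is a covering
relation and lowers the dimension by one. -/
theorem IsPolytope.polyDim_add_ncard [Finite α] (hP : IsPolytope P)
    (Φ : Face P ≃o Diagonalizations r) (U : Diagonalizations r) :
    polyDim (Φ.symm U).1 + U.diagonals.ncard = polyDim P := by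
  suffices h : ∀ (T : Set α) (hT : T.Pairwise r),
      polyDim (Φ.symm (mk r T hT)).1 + T.ncard = polyDim P from h U.diagonals U.pairwise
  intro T
  induction T, T.toFinite using Set.Finite.induction_on with
  | empty =>
    intro hT
    have h : P ⊆ (Φ.symm (mk r ∅ hT)).1 :=
      (Φ.le_symm_apply (x := ⟨P, IsExposed.refl P, hP.nonempty⟩)).2 (isTop_empty _)
    rw [Set.ncard_empty, add_zero, (Φ.symm (mk r ∅ hT)).2.1.subset.antisymm h]
  | @insert a T ha hfin ih =>
    intro hT
    have := hP.polyDim_covBy ((apply_covBy_apply_iff Φ.symm).2 (mk_insert_covBy ha hT))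
    have h2 := ih (hT.mono (Set.subset_insert a T))
    rw [Set.ncard_insert_of_notMem ha hfin]
    omega

/-- Fixing a minimal element in one factor and letting the other vary singles out a face of the
facet with the varying factor as face poset; this provides `A` and `B`. The minimal element `W` is
prescribed because its cardinality is the dimension of `B`. -/
theorem IsPolytope.exists_prod_face_single [Finite α] [Finite β] (hP : IsPolytope P)
    (Φ : Face P ≃o Diagonalizations r) {D : α} {f : β → α} {g : γ → α} (hr : ∀ x y, r x y → r y x)
    (hinj : Function.Injective (Sum.elim f g))
    (hrange : ∀ x, x ∈ Set.range (Sum.elim f g) ↔ x ≠ D ∧ r D x)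
    (hf : ∀ x y, s x y ↔ r (f x) (f y)) (hg : ∀ x y, t x y ↔ r (g x) (g y))
    (hfg : ∀ x y, r (f x) (g y)) {W : Diagonalizations t} (hW : IsMin W) :
    ∃ A B : Set E, IsPolytope A ∧ IsPolytope B ∧ Nonempty (Face A ≃o Diagonalizations s) ∧
      Nonempty (Face B ≃o Diagonalizations t) ∧
      polyDim A + 1 + W.diagonals.ncard = polyDim P ∧ polyDim B = W.diagonals.ncard ∧
      CombEquiv (Φ.symm (single r D)).1 (A ×ˢ B) := by
  obtain ⟨e, he⟩ := exists_linkIso hr hinj hrange hf hg hfg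
  let Θ := (hP.faceSingleIso Φ D).trans e.symm
  have hQ : IsPolytope (Φ.symm (single r D)).1 :=
    hP.of_isExposed (Φ.symm (single r D)).2.1 (Φ.symm (single r D)).2.2
  have hdim : ∀ V, polyDim (Θ.symm V).1 + 1 + V.1.diagonals.ncard + V.2.diagonals.ncard =
      polyDim P := by
    intro V
    have h := hP.polyDim_add_ncard Φ (e V).1
    have := Finite.of_injective _ hinj
    have : Finite γ := Finite.of_injective (Sum.inr (α := β)) Sum.inr_injective
    rw [he V, Set.ncard_insert_of_notMem, Set.ncard_image_of_injective _ hinj,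
      Set.ncard_union_eq, Set.ncard_image_of_injective _ Sum.inl_injective,
      Set.ncard_image_of_injective _ Sum.inr_injective] at h
    · have heq : (Θ.symm V).1 = (Φ.symm (e V).1).1 := rfl
      rw [heq]
      omega
    · rw [Set.disjoint_left]
      rintro _ ⟨x, -, rfl⟩ ⟨y, -, hy⟩
      cases hy
    · rintro ⟨x, -, hx⟩
      exact ((hrange _).1 ⟨x, rfl⟩).1 hx
  obtain ⟨V, hV⟩ := exists_isMin (r := s)
  have hmin : IsMin (V, W) := fun p hp => ⟨hV hp.1, hW hp.2⟩
  have hA := hdim (empty s, W)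
  have hB := hdim (V, empty t)
  have hAB := hdim (V, W)
  -- The pair `(V, W)` gives a vertex of the facet, so its diagonals together with `D` number
  -- `polyDim P`; comparison with `hB` yields the dimension of `B`.
  rw [hQ.polyDim_eq_zero_of_isMin (Θ.symm.isMin_apply.2 hmin)] at hAB
  simp only [empty, diagonals_mk, Set.ncard_empty] at hA hB
  have isoA : Face (Θ.symm (empty s, W)).1 ≃o Diagonalizations s :=
    (hQ.faceIso _).trans ((Θ.symm.iicCongr _).symm.trans
      (OrderIso.iicTopMin isTop_empty hW).symm)
  have isoB : Face (Θ.symm (V, empty t)).1 ≃o Diagonalizations t :=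
    (hQ.faceIso _).trans ((Θ.symm.iicCongr _).symm.trans
      (OrderIso.iicMinTop isTop_empty hV).symm)
  refine ⟨_, _, hQ.of_isExposed (Θ.symm (empty s, W)).2.1 (Θ.symm (empty s, W)).2.2,
    hQ.of_isExposed (Θ.symm (V, empty t)).2.1 (Θ.symm (V, empty t)).2.2, ⟨isoA⟩, ⟨isoB⟩, hA, ?_, ?_⟩
  · simp only [empty] at hAB ⊢
    omega
  · obtain ⟨ι⟩ := nonempty_faceProdIso (Θ.symm (empty s, W)).1 (Θ.symm (V, empty t)).1
    let κ : Diagonalizations s × Diagonalizations t ≃o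
        Face (Θ.symm (empty s, W)).1 × Face (Θ.symm (V, empty t)).1 :=
      { isoA.symm.toEquiv.prodCongr isoB.symm.toEquiv with
        map_rel_iff' := and_congr isoA.symm.le_iff_le isoB.symm.le_iff_le }
    exact ⟨(Θ.trans κ).trans ι⟩

/-- The facets correspond to the single diagonals. -/
theorem IsPolytope.exists_facetEquiv [Finite α] (hP : IsPolytope P)
    (Φ : Face P ≃o Diagonalizations r) :
    ∃ e : α ≃ Facet P, ∀ D, (e D).1 = (Φ.symm (single r D)).1 := by
  have hdim : ∀ D, polyDim (Φ.symm (single r D)).1 + 1 = polyDim P := fun D => by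
    rw [← hP.polyDim_add_ncard Φ (single r D)]
    simp [single, diagonals_mk]
  let φ : α → Facet P := fun D =>
    ⟨(Φ.symm (single r D)).1, (Φ.symm (single r D)).2.1, (Φ.symm (single r D)).2.2, hdim D⟩
  refine ⟨Equiv.ofBijective φ ⟨fun D D' h => ?_, fun F => ?_⟩, fun D => rfl⟩
  · have h1 : (Φ.symm (single r D)).1 = (Φ.symm (single r D')).1 := congrArg (fun F : Facet P => F.1) h
    have h2 := congrArg diagonals (Φ.symm.injective (Subtype.ext h1))
    exact Set.singleton_injective h2
  · have h := hP.polyDim_add_ncard Φ (Φ ⟨F.1, F.2.1, F.2.2.1⟩)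
    have hF := F.2.2.2
    rw [OrderIso.symm_apply_apply] at h
    obtain ⟨D, hD⟩ := Set.ncard_eq_one.1 (add_left_cancel (h.trans hF.symm))
    have hs : single r D = Φ ⟨F.1, F.2.1, F.2.2.1⟩ := diagonals_injective hD.symm
    refine ⟨D, Subtype.ext ?_⟩
    change (Φ.symm (single r D)).1 = F.1
    rw [hs, OrderIso.symm_apply_apply]

end Realization

/-! ### Chords with integer labels

The vertices of the `2n`-gon are labelled by integers modulo `2n`, so that a chord that cuts off
`w ≤ n` sides is given by its two ends `a` and `a + w`. -/

section Chords

/-- The open intervals `(a, b)` and `(c, d)` overlap without one containing the other. -/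
def Overlap (a b c d : ℤ) : Prop := (a < c ∧ c < b ∧ b < d) ∨ (c < a ∧ a < d ∧ d < b)

theorem overlap_add (a b c d s : ℤ) :
    Overlap (a + s) (b + s) (c + s) (d + s) ↔ Overlap a b c d := by
  unfold Overlap
  omega

variable (n : ℕ) [NeZero n]

/-- The vertex of the `2n`-gon with integer label `a`. -/
def vertex (a : ℤ) : Fin (2 * n) :=
  ⟨(a % (2 * n : ℤ)).toNat, by
    have hn : (0 : ℤ) < n := by exact_mod_cast Nat.pos_of_ne_zero (NeZero.ne n)
    have := Int.emod_nonneg a (show (2 * n : ℤ) ≠ 0 by omega)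
    have := Int.emod_lt_of_pos a (show (0 : ℤ) < 2 * n by omega)
    omega⟩

theorem natCast_pos_of_neZero : (0 : ℤ) < n := by
  exact_mod_cast Nat.pos_of_ne_zero (NeZero.ne n)

theorem val_vertex (a : ℤ) : ((vertex n a : ℕ) : ℤ) = a % (2 * n : ℤ) :=
  Int.toNat_of_nonneg (Int.emod_nonneg a (by have := natCast_pos_of_neZero n; omega))

theorem vertex_eq_iff {a b : ℤ} : vertex n a = vertex n b ↔ ∃ t : ℤ, b = a + 2 * n * t := by
  rw [Fin.ext_iff, ← Int.natCast_inj, val_vertex, val_vertex]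
  constructor
  · intro h
    obtain ⟨t, ht⟩ := Int.ModEq.dvd h
    exact ⟨t, by linarith⟩
  · rintro ⟨t, rfl⟩
    rw [Int.add_mul_emod_self_left]

theorem vertex_add (a t : ℤ) : vertex n (a + 2 * n * t) = vertex n a :=
  ((vertex_eq_iff n).2 ⟨t, rfl⟩).symm

theorem vertex_natCast (p : Fin (2 * n)) : vertex n (p : ℕ) = p := by
  have h : ((p : ℕ) : ℤ) < 2 * n := by exact_mod_cast p.isLt
  rw [Fin.ext_iff, ← Int.natCast_inj, val_vertex, Int.emod_eq_of_lt (by omega) h]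

theorem val_vertex_of_lt {a : ℤ} (h0 : 0 ≤ a) (h : a < 2 * n) : ((vertex n a : ℕ) : ℤ) = a := by
  rw [val_vertex, Int.emod_eq_of_lt h0 h]

theorem val_vertex_of_le {a : ℤ} (h0 : 2 * n ≤ a) (h : a < 4 * n) :
    ((vertex n a : ℕ) : ℤ) = a - 2 * n := by
  rw [← val_vertex_of_lt n (a := a - 2 * n) (by omega) (by omega), ← vertex_add n a (-1)]
  congr 3
  ring

theorem antipode_vertex (a : ℤ) : antipode (vertex n a) = vertex n (a + n) := by
  rw [Fin.ext_iff, ← Int.natCast_inj, val_vertex, antipode]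
  push_cast
  rw [val_vertex, Int.emod_add_emod]

/-- The chord with ends labelled `a` and `b`. -/
def chord (a b : ℤ) : Sym2 (Fin (2 * n)) := s(vertex n a, vertex n b)

theorem chord_add (a b t : ℤ) : chord n (a + 2 * n * t) (b + 2 * n * t) = chord n a b := by
  rw [chord, vertex_add, vertex_add, chord]

theorem chord_map_antipode (a b : ℤ) :
    (chord n a b).map antipode = chord n (a + n) (b + n) := by
  rw [chord, Sym2.map_mk, antipode_vertex, antipode_vertex, chord]

/-- Labels of width at most `n` determine a chord up to full turns, except that a diameter may also
be read from its other end. -/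
theorem chord_eq_iff {a b c d : ℤ} (hab : a < b) (hab' : b ≤ a + n) (hcd : c < d)
    (hcd' : d ≤ c + n) : chord n a b = chord n c d ↔
      ∃ t : ℤ, (c = a + 2 * n * t ∧ d = b + 2 * n * t) ∨
        (b = a + n ∧ c = b + 2 * n * t ∧ d = c + n) := by
  have hn := natCast_pos_of_neZero n
  constructor
  · intro h
    rw [chord, chord, Sym2.eq_iff, vertex_eq_iff, vertex_eq_iff, vertex_eq_iff, vertex_eq_iff] at h
    rcases h with ⟨⟨t, rfl⟩, ⟨u, rfl⟩⟩ | ⟨⟨u, rfl⟩, ⟨t, rfl⟩⟩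
    · have h1 : u < t + 1 := by nlinarith
      have h2 : t < u + 1 := by nlinarith
      obtain rfl : u = t := by omega
      exact ⟨u, Or.inl ⟨rfl, rfl⟩⟩
    · have h1 : t < u := by nlinarith
      have h2 : u < t + 2 := by nlinarith
      obtain rfl : u = t + 1 := by omega
      refine ⟨t, Or.inr ?_⟩
      constructor
      · nlinarith
      · exact ⟨rfl, by nlinarith⟩
  · rintro ⟨t, ⟨rfl, rfl⟩ | ⟨rfl, rfl, rfl⟩⟩
    · rw [chord_add]
    · rw [chord, chord, Sym2.eq_iff]
      refine Or.inr ⟨(vertex_eq_iff n).2 ⟨t + 1, by ring⟩, (vertex_eq_iff n).2 ⟨t, by ring⟩⟩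

theorem exists_mem_Ico_add {c : ℤ} (i a : ℤ) (hc : 0 < c) :
    ∃ t : ℤ, i ≤ a + c * t ∧ a + c * t < i + c := by
  refine ⟨-((a - i) / c), ?_⟩
  have h1 := Int.emod_nonneg (a - i) hc.ne'
  have h2 := Int.emod_lt_of_pos (a - i) hc
  have h3 := Int.mul_ediv_add_emod (a - i) c
  constructor <;> linarith

theorem crosses_mk_iff {N : ℕ} {x y z w : Fin N} : Crosses s(x, y) s(z, w) ↔
    (x < z ∧ z < y ∧ y < w) ∨ (x < w ∧ w < y ∧ y < z) ∨ (y < z ∧ z < x ∧ x < w) ∨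
    (y < w ∧ w < x ∧ x < z) ∨ (z < x ∧ x < w ∧ w < y) ∨ (w < x ∧ x < z ∧ z < y) ∨
    (z < y ∧ y < w ∧ w < x) ∨ (w < y ∧ y < z ∧ z < x) := by
  constructor
  · rintro ⟨a, b, c, d, h1, h2, h3, ⟨h4, h5⟩ | ⟨h4, h5⟩⟩ <;> rw [Sym2.eq_iff] at h4 h5 <;>
      rcases h4 with ⟨rfl, rfl⟩ | ⟨rfl, rfl⟩ <;> rcases h5 with ⟨rfl, rfl⟩ | ⟨rfl, rfl⟩ <;>
      simp only [h1, h2, h3, and_self, true_or, or_true]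
  · rintro (h | h | h | h | h | h | h | h)
    · exact ⟨x, y, z, w, h.1, h.2.1, h.2.2, Or.inl ⟨rfl, rfl⟩⟩
    · exact ⟨x, y, w, z, h.1, h.2.1, h.2.2, Or.inl ⟨rfl, Sym2.eq_swap⟩⟩
    · exact ⟨y, x, z, w, h.1, h.2.1, h.2.2, Or.inl ⟨Sym2.eq_swap, rfl⟩⟩
    · exact ⟨y, x, w, z, h.1, h.2.1, h.2.2, Or.inl ⟨Sym2.eq_swap, Sym2.eq_swap⟩⟩
    · exact ⟨z, w, x, y, h.1, h.2.1, h.2.2, Or.inr ⟨rfl, rfl⟩⟩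
    · exact ⟨w, z, x, y, h.1, h.2.1, h.2.2, Or.inr ⟨rfl, Sym2.eq_swap⟩⟩
    · exact ⟨z, w, y, x, h.1, h.2.1, h.2.2, Or.inr ⟨Sym2.eq_swap, rfl⟩⟩
    · exact ⟨w, z, y, x, h.1, h.2.1, h.2.2, Or.inr ⟨Sym2.eq_swap, Sym2.eq_swap⟩⟩

theorem crosses_comm {N : ℕ} {e f : Sym2 (Fin N)} : Crosses e f ↔ Crosses f e := by
  constructor <;>
  · rintro ⟨a, b, c, d, h1, h2, h3, h⟩
    exact ⟨a, b, c, d, h1, h2, h3, h.symm.imp And.symm And.symm⟩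

/-- With both starts in one period and widths at most `n`, only translates by at most one full turn
can overlap. -/
theorem crosses_chord_iff_of_lt {a b c d : ℤ} (hab : a < b) (hab' : b ≤ a + n) (hcd : c < d)
    (hcd' : d ≤ c + n) (ha : 0 ≤ a) (ha' : a < 2 * n) (hc : 0 ≤ c) (hc' : c < 2 * n) :
    Crosses (chord n a b) (chord n c d) ↔
      Overlap a b (c - 2 * n) (d - 2 * n) ∨ Overlap a b c d ∨
        Overlap a b (c + 2 * n) (d + 2 * n) := by
  have hx := val_vertex_of_lt n ha ha'
  have hz := val_vertex_of_lt n hc hc'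
  have hy : b < 2 * n ∧ ((vertex n b : ℕ) : ℤ) = b ∨
      2 * n ≤ b ∧ ((vertex n b : ℕ) : ℤ) = b - 2 * n := by
    rcases lt_or_ge b (2 * n) with h | h
    · exact Or.inl ⟨h, val_vertex_of_lt n (by omega) h⟩
    · exact Or.inr ⟨h, val_vertex_of_le n h (by omega)⟩
  have hw : d < 2 * n ∧ ((vertex n d : ℕ) : ℤ) = d ∨
      2 * n ≤ d ∧ ((vertex n d : ℕ) : ℤ) = d - 2 * n := by
    rcases lt_or_ge d (2 * n) with h | h
    · exact Or.inl ⟨h, val_vertex_of_lt n (by omega) h⟩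
    · exact Or.inr ⟨h, val_vertex_of_le n h (by omega)⟩
  rw [chord, chord, crosses_mk_iff]
  simp only [Fin.lt_def]
  unfold Overlap
  generalize (vertex n a : ℕ) = x at *
  generalize (vertex n b : ℕ) = y at *
  generalize (vertex n c : ℕ) = z at *
  generalize (vertex n d : ℕ) = w at *
  rcases hy with hy | hy <;> rcases hw with hw | hw <;> omega

theorem crosses_chord_iff {a b c d : ℤ} (hab : a < b) (hab' : b ≤ a + n) (hcd : c < d)
    (hcd' : d ≤ c + n) : Crosses (chord n a b) (chord n c d) ↔
      ∃ t : ℤ, Overlap a b (c + 2 * n * t) (d + 2 * n * t) := by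
  have hn := natCast_pos_of_neZero n
  obtain ⟨u, hu, hu'⟩ := exists_mem_Ico_add 0 a (show (0 : ℤ) < 2 * n by omega)
  obtain ⟨v, hv, hv'⟩ := exists_mem_Ico_add 0 c (show (0 : ℤ) < 2 * n by omega)
  rw [← chord_add n a b u, ← chord_add n c d v, crosses_chord_iff_of_lt n (by omega) (by omega)
    (by omega) (by omega) hu (by omega) hv (by omega)]
  constructor
  · rintro (h | h | h)
    · refine ⟨v - u - 1, (overlap_add _ _ _ _ (2 * n * u)).1 ?_⟩
      convert h using 1 <;> ring
    · refine ⟨v - u, (overlap_add _ _ _ _ (2 * n * u)).1 ?_⟩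
      convert h using 1 <;> ring
    · refine ⟨v - u + 1, (overlap_add _ _ _ _ (2 * n * u)).1 ?_⟩
      convert h using 1 <;> ring
  · rintro ⟨t, ht⟩
    rw [← overlap_add _ _ _ _ (2 * n * u)] at ht
    obtain ⟨q, rfl⟩ : ∃ q, t = q + (v - u) := ⟨t - (v - u), by ring⟩
    have e : ∀ x : ℤ, x + 2 * n * (q + (v - u)) + 2 * n * u = x + 2 * n * v + 2 * n * q :=
      fun x => by ring
    rw [e, e] at ht
    -- Overlapping intervals meet, and after normalization their starts lie in `[0, 2n)` and their
    -- widths are at most `n`; this bounds the shift by `3n` in both directions.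
    have hq : q < 2 := by
      have : 2 * n * q < 3 * n := by
        unfold Overlap at ht
        omega
      nlinarith
    have hq' : -2 < q := by
      have : -(3 * n) < 2 * n * q := by
        unfold Overlap at ht
        omega
      nlinarith
    obtain rfl | rfl | rfl : q = -1 ∨ q = 0 ∨ q = 1 := by omega
    · refine Or.inl ?_
      convert ht using 1 <;> ring
    · refine Or.inr (Or.inl ?_)
      convert ht using 1 <;> ring
    · refine Or.inr (Or.inr ?_)
      convert ht using 1 <;> ring

end Chords

/-! ### Integer labels for the diagonals of the polygon with a central vertex -/

theorem nonCrossing_comm {N : ℕ} {D D' : Set (Sym2 (Fin N))} :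
    NonCrossing D D' ↔ NonCrossing D' D :=
  ⟨fun h d hd d' hd' hc => h d' hd' d hd (crosses_comm.1 hc),
    fun h d hd d' hd' hc => h d' hd' d hd (crosses_comm.1 hc)⟩

theorem CentralDiagonal.nonCrossing_symm {n : ℕ} (x y : CentralDiagonal n) (h : x.NonCrossing y) : y.NonCrossing x := by
  rcases x with _ | D | e <;> rcases y with _ | D' | e'
  · trivial
  · trivial
  · exact h
  · trivial
  · exact nonCrossing_comm.1 h
  · exact nonCrossing_comm.1 h
  · exact h
  · exact nonCrossing_comm.1 h
  · trivial

instance {m : ℕ} : Finite (CentralDiagonal m) := by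
  let f : CentralDiagonal m → Unit ⊕ SymDiagonal m ⊕
      {e : Sym2 (Fin (2 * m)) // ∃ i, e = s(i, antipode i)} := fun
    | .circle => Sum.inl ()
    | .pair D => Sum.inr (Sum.inl D)
    | .diameter e => Sum.inr (Sum.inr e)
  refine Finite.of_injective f ?_
  rintro (_ | D | e) (_ | D' | e') h <;> simp_all [f]

section Labels

variable (n : ℕ) [NeZero n]

/-- A chord together with its image under the central symmetry. -/
def chordPair (a b : ℤ) : Set (Sym2 (Fin (2 * n))) := {chord n a b, chord n (a + n) (b + n)}

/-- Even multiples of `n` are full turns; odd ones exchange the two chords of the pair. Pairs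
therefore have labels modulo `n`. -/
theorem chordPair_add (a b t : ℤ) : chordPair n (a + n * t) (b + n * t) = chordPair n a b := by
  obtain ⟨u, rfl | rfl⟩ := Int.even_or_odd' t
  · rw [chordPair, show a + n * (2 * u) = a + 2 * n * u by ring,
      show b + n * (2 * u) = b + 2 * n * u by ring, chord_add,
      show a + 2 * n * u + n = a + n + 2 * n * u by ring,
      show b + 2 * n * u + n = b + n + 2 * n * u by ring, chord_add, chordPair]
  · rw [chordPair, show a + n * (2 * u + 1) = a + n + 2 * n * u by ring,
      show b + n * (2 * u + 1) = b + n + 2 * n * u by ring, chord_add,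
      show a + n + 2 * n * u + n = a + 2 * n * (u + 1) by ring,
      show b + n + 2 * n * u + n = b + 2 * n * (u + 1) by ring, chord_add, Set.pair_comm, chordPair]

theorem chordPair_eq_iff {a b c d : ℤ} (hab : a < b) (hab' : b ≤ a + n) (hcd : c < d)
    (hcd' : d ≤ c + n) :
    chordPair n a b = chordPair n c d ↔ ∃ t : ℤ, c = a + n * t ∧ d = b + n * t := by
  constructor
  · intro h
    have hmem : chord n c d ∈ chordPair n a b := h ▸ Set.mem_insert _ _
    rcases hmem with hmem | hmem
    · obtain ⟨t, ⟨h1, h2⟩ | ⟨h1, h2, h3⟩⟩ :=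
        (chord_eq_iff n hab hab' hcd hcd').1 hmem.symm
      · exact ⟨2 * t, by linarith, by linarith⟩
      · exact ⟨2 * t + 1, by linarith, by linarith⟩
    · obtain ⟨t, ⟨h1, h2⟩ | ⟨h1, h2, h3⟩⟩ :=
        (chord_eq_iff n (by omega) (by omega) hcd hcd').1 (Set.mem_singleton_iff.1 hmem).symm
      · exact ⟨2 * t + 1, by linarith, by linarith⟩
      · exact ⟨2 * t + 2, by linarith, by linarith⟩
  · rintro ⟨t, rfl, rfl⟩
    rw [chordPair_add]

theorem nonCrossing_chordPair_iff {a b c d : ℤ} (hab : a < b) (hab' : b ≤ a + n) (hcd : c < d)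
    (hcd' : d ≤ c + n) : NonCrossing (chordPair n a b) (chordPair n c d) ↔
      ∀ t : ℤ, ¬ Overlap a b (c + n * t) (d + n * t) := by
  have key : ∀ e f : ℤ, Crosses (chord n (a + e) (b + e)) (chord n (c + f) (d + f)) ↔
      ∃ t : ℤ, Overlap (a + e) (b + e) (c + f + 2 * n * t) (d + f + 2 * n * t) := fun e f =>
    crosses_chord_iff n (by omega) (by omega) (by omega) (by omega)
  constructor
  · intro h t ht
    obtain ⟨u, rfl | rfl⟩ := Int.even_or_odd' t
    · refine h _ (Set.mem_insert _ _) _ (Set.mem_insert _ _)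
        ((crosses_chord_iff n hab hab' hcd hcd').2 ⟨u, ?_⟩)
      convert ht using 1 <;> ring
    · refine h _ (Set.mem_insert _ _) _ (Set.mem_insert_of_mem _ rfl)
        ((crosses_chord_iff n hab hab' (by omega) (by omega)).2 ⟨u, ?_⟩)
      convert ht using 1 <;> ring
  · intro h
    have hmem : ∀ {a b : ℤ} {x}, x ∈ chordPair n a b →
        ∃ u : ℤ, x = chord n (a + n * u) (b + n * u) := by
      rintro a b x (rfl | rfl)
      · exact ⟨0, by simp⟩
      · exact ⟨1, by simp⟩
    intro x hx y hy hc
    obtain ⟨u, rfl⟩ := hmem hx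
    obtain ⟨v, rfl⟩ := hmem hy
    obtain ⟨t, ht⟩ := (key _ _).1 hc
    refine h (v - u + 2 * t) ((overlap_add _ _ _ _ (n * u)).1 ?_)
    convert ht using 1 <;> ring

/-- A diameter is the degenerate pair of width `n` whose two chords coincide. An interval of width
at most `n` overlaps one of width `n` exactly when it contains one of its ends. -/
theorem nonCrossing_chordPair_singleton_iff {a b i : ℤ} (hab : a < b) (hab' : b ≤ a + n) :
    NonCrossing (chordPair n a b) {chord n i (i + n)} ↔
      ∀ t : ℤ, ¬ (a < i + n * t ∧ i + n * t < b) := by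
  have hn := natCast_pos_of_neZero n
  have hpair : chordPair n i (i + n) = {chord n i (i + n)} := by
    have h : chord n i (i + n) = chord n (i + n) (i + n + n) :=
      (chord_eq_iff n (by omega) le_rfl (by omega) le_rfl).2 ⟨0, Or.inr ⟨rfl, by ring, rfl⟩⟩
    rw [chordPair, ← h, Set.pair_eq_singleton]
  rw [← hpair, nonCrossing_chordPair_iff n hab hab' (by omega) (by omega)]
  unfold Overlap
  constructor
  · intro h t ht
    exact h t (by omega)
  · rintro h t (ht | ht)
    · exact h t (by omega)
    · exact h (t + 1) (by rw [mul_add, mul_one]; omega)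

theorem isDiagonal_chord {a b : ℤ} (hab : a + 2 ≤ b) (hab' : b ≤ a + n) :
    IsDiagonal (chord n a b) := by
  have hn := natCast_pos_of_neZero n
  obtain ⟨u, hu, hu'⟩ := exists_mem_Ico_add 0 a (show (0 : ℤ) < 2 * n by omega)
  rw [← chord_add n a b u]
  have hx := val_vertex_of_lt n hu (by omega)
  rcases lt_or_ge (b + 2 * n * u) (2 * n) with h | h
  · have hy := val_vertex_of_lt n (by omega) h
    exact ⟨_, _, rfl, by omega, by omega⟩
  · have hy := val_vertex_of_le n h (by omega)
    exact ⟨_, _, Sym2.eq_swap, by omega, by omega⟩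

variable {n}

namespace CentralDiagonal

/-- The pair of diagonals that cut off the vertices with labels strictly between `a` and `b`. -/
def pairOf (a b : ℤ) (h : a + 2 ≤ b ∧ b ≤ a + n) : CentralDiagonal n :=
  .pair ⟨chordPair n a b, chord n a b, isDiagonal_chord n h.1 h.2, by
    rw [chord_map_antipode, chordPair]⟩

/-- The single diameter through the vertex with label `i`. -/
def diameterOf (i : ℤ) : CentralDiagonal n :=
  .diameter ⟨chord n i (i + n), vertex n i, by rw [antipode_vertex, chord]⟩

theorem pairOf_eq_pairOf_iff {a b c d : ℤ} {h : a + 2 ≤ b ∧ b ≤ a + n}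
    {h' : c + 2 ≤ d ∧ d ≤ c + n} :
    pairOf a b h = pairOf c d h' ↔ ∃ t : ℤ, c = a + n * t ∧ d = b + n * t := by
  rw [pairOf, pairOf, CentralDiagonal.pair.injEq, Subtype.mk.injEq,
    chordPair_eq_iff n (by omega) h.2 (by omega) h'.2]

theorem diameterOf_eq_diameterOf_iff {i j : ℤ} :
    diameterOf (n := n) i = diameterOf j ↔ ∃ t : ℤ, j = i + n * t := by
  have hn := natCast_pos_of_neZero n
  rw [diameterOf, diameterOf, CentralDiagonal.diameter.injEq, Subtype.mk.injEq,
    chord_eq_iff n (by omega) le_rfl (by omega) le_rfl]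
  constructor
  · rintro ⟨t, h | h⟩
    · exact ⟨2 * t, by linarith⟩
    · exact ⟨2 * t + 1, by linarith⟩
  · rintro ⟨t, rfl⟩
    obtain ⟨u, rfl | rfl⟩ := Int.even_or_odd' t
    · exact ⟨u, Or.inl ⟨by ring, by ring⟩⟩
    · exact ⟨u, Or.inr ⟨rfl, by ring, rfl⟩⟩

theorem pairOf_ne_diameterOf {a b i : ℤ} (h : a + 2 ≤ b ∧ b ≤ a + n) :
    pairOf a b h ≠ diameterOf i := fun h => by cases h

theorem pairOf_ne_circle {a b : ℤ} (h : a + 2 ≤ b ∧ b ≤ a + n) : pairOf a b h ≠ circle :=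
  fun h => by cases h

theorem diameterOf_ne_circle {i : ℤ} : diameterOf (n := n) i ≠ circle := fun h => by cases h

theorem exists_eq_pairOf (D : SymDiagonal n) :
    ∃ p : {p : ℤ × ℤ // p.1 + 2 ≤ p.2 ∧ p.2 ≤ p.1 + n},
      CentralDiagonal.pair D = pairOf p.1.1 p.1.2 p.2 := by
  obtain ⟨_, d, ⟨p, q, rfl, h1, h2⟩, rfl⟩ := D
  have key : ∀ p q : ℤ, ∀ h : p + 2 ≤ q ∧ q ≤ p + n, ∀ D : SymDiagonal n,
      D.1 = {chord n p q, (chord n p q).map antipode} →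
        CentralDiagonal.pair D = pairOf p q h := by
    rintro p q h D hD
    exact congrArg CentralDiagonal.pair
      (Subtype.ext (hD.trans (congrArg (fun e => {chord n p q, e}) (chord_map_antipode n p q))))
  -- The arc with at most `n` sides is used: if the one from `p` to `q` is too long, the labels run
  -- from `q` to `p + 2n`.
  by_cases hpq : (q : ℕ) ≤ (p : ℕ) + n
  · refine ⟨⟨((p : ℕ), (q : ℕ)), by push_cast; omega, by push_cast; omega⟩, key _ _ _ _ ?_⟩
    simp only [chord, vertex_natCast]
  · refine ⟨⟨((q : ℕ), (p : ℕ) + 2 * n * 1), by push_cast; omega, by push_cast; omega⟩,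
      key _ _ _ _ ?_⟩
    have h : chord n (q : ℕ) ((p : ℕ) + 2 * n * 1) = s(p, q) := by
      rw [chord, vertex_natCast, vertex_add, vertex_natCast, Sym2.eq_swap]
    rw [h]

theorem exists_eq_diameterOf (e : {e : Sym2 (Fin (2 * n)) // ∃ i, e = s(i, antipode i)}) :
    ∃ i : ℤ, CentralDiagonal.diameter e = diameterOf i := by
  obtain ⟨_, i, rfl⟩ := e
  refine ⟨(i : ℕ), ?_⟩
  rw [diameterOf, CentralDiagonal.diameter.injEq, Subtype.mk.injEq, chord, ← antipode_vertex,
    vertex_natCast]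

theorem pairOf_add (a b t : ℤ) (h : a + 2 ≤ b ∧ b ≤ a + n) :
    pairOf a b h = pairOf (a + n * t) (b + n * t) ⟨by omega, by omega⟩ :=
  pairOf_eq_pairOf_iff.2 ⟨t, rfl, rfl⟩

theorem diameterOf_add (i t : ℤ) : diameterOf (n := n) i = diameterOf (i + n * t) :=
  diameterOf_eq_diameterOf_iff.2 ⟨t, rfl⟩

/-- Every diagonal has labels that start in a prescribed window of length `n`. -/
theorem eq_circle_or_pairOf_or_diameterOf (x : CentralDiagonal n) (i : ℤ) :
    x = circle ∨ (∃ a b h, i ≤ a ∧ a < i + n ∧ x = pairOf a b h) ∨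
      ∃ j, i ≤ j ∧ j < i + n ∧ x = diameterOf j := by
  have hn := natCast_pos_of_neZero n
  rcases x with _ | D | e
  · exact Or.inl rfl
  · obtain ⟨⟨⟨a, b⟩, h⟩, hD⟩ := exists_eq_pairOf D
    obtain ⟨t, ht, ht'⟩ := exists_mem_Ico_add i a hn
    exact Or.inr (Or.inl ⟨_, _, _, ht, ht', hD.trans (pairOf_add a b t h)⟩)
  · obtain ⟨j, hj⟩ := exists_eq_diameterOf e
    obtain ⟨t, ht, ht'⟩ := exists_mem_Ico_add i j hn
    exact Or.inr (Or.inr ⟨_, ht, ht', hj.trans (diameterOf_add j t)⟩)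

theorem nonCrossing_pairOf_pairOf {a b c d : ℤ} (h : a + 2 ≤ b ∧ b ≤ a + n)
    (h' : c + 2 ≤ d ∧ d ≤ c + n) : (pairOf a b h).NonCrossing (pairOf c d h') ↔
      ∀ t : ℤ, ¬ Overlap a b (c + n * t) (d + n * t) :=
  nonCrossing_chordPair_iff n (by omega) h.2 (by omega) h'.2

theorem nonCrossing_pairOf_diameterOf {a b i : ℤ} (h : a + 2 ≤ b ∧ b ≤ a + n) :
    (pairOf a b h).NonCrossing (diameterOf i) ↔ ∀ t : ℤ, ¬ (a < i + n * t ∧ i + n * t < b) :=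
  nonCrossing_chordPair_singleton_iff n (by omega) h.2

theorem nonCrossing_diameterOf_pairOf {a b i : ℤ} (h : a + 2 ≤ b ∧ b ≤ a + n) :
    (diameterOf i).NonCrossing (pairOf a b h) ↔ ∀ t : ℤ, ¬ (a < i + n * t ∧ i + n * t < b) :=
  nonCrossing_comm.trans (nonCrossing_chordPair_singleton_iff n (by omega) h.2)

end CentralDiagonal

end Labels

/-! ### Diagonals that are compatible with a given one -/

/-- Used to discard all translates by nonzero multiples of `n` when the labels stay within one
window. -/
theorem Int.eq_zero_of_mul_lt {n t : ℤ} (h1 : -n < n * t) (h2 : n * t < n) : t = 0 := by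
  have hn : 0 < n := by linarith
  have h3 : -1 < t := by nlinarith
  have h4 : t < 1 := by nlinarith
  omega

/-! ### Integer ends of the diagonals of an ordinary polygon. -/

section PolygonDiagonal

variable {N : ℕ}

theorem IsDiagonal.exists_labels (e : {e : Sym2 (Fin N) // IsDiagonal e}) :
    ∃ p : Fin N × Fin N, e.1 = s(p.1, p.2) ∧ (p.1 : ℕ) + 2 ≤ p.2 ∧ (p.2 : ℕ) + 2 ≤ p.1 + N := by
  obtain ⟨a, b, h⟩ := e.2
  exact ⟨(a, b), h⟩

/-- The smaller end of a diagonal. -/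
noncomputable def lowerEnd (e : {e : Sym2 (Fin N) // IsDiagonal e}) : ℤ :=
  ((IsDiagonal.exists_labels e).choose.1 : ℕ)

/-- The larger end of a diagonal. -/
noncomputable def upperEnd (e : {e : Sym2 (Fin N) // IsDiagonal e}) : ℤ :=
  ((IsDiagonal.exists_labels e).choose.2 : ℕ)

theorem exists_ends (e : {e : Sym2 (Fin N) // IsDiagonal e}) :
    ∃ a b : Fin N, e.1 = s(a, b) ∧ lowerEnd e = (a : ℕ) ∧ upperEnd e = (b : ℕ) :=
  ⟨_, _, (IsDiagonal.exists_labels e).choose_spec.1, rfl, rfl⟩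

theorem ends_bounds (e : {e : Sym2 (Fin N) // IsDiagonal e}) :
    0 ≤ lowerEnd e ∧ lowerEnd e + 2 ≤ upperEnd e ∧ upperEnd e < N ∧
      upperEnd e + 2 ≤ lowerEnd e + N := by
  have h := (IsDiagonal.exists_labels e).choose_spec.2
  have h2 := (IsDiagonal.exists_labels e).choose.2.isLt
  unfold lowerEnd upperEnd
  omega

theorem eq_of_ends_eq {e f : {e : Sym2 (Fin N) // IsDiagonal e}}
    (h : lowerEnd e = lowerEnd f) (h' : upperEnd e = upperEnd f) : e = f := by
  obtain ⟨a, b, he, ha, hb⟩ := exists_ends e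
  obtain ⟨c, d, hf, hc, hd⟩ := exists_ends f
  obtain rfl : a = c := Fin.ext (by omega)
  obtain rfl : b = d := Fin.ext (by omega)
  exact Subtype.ext (he.trans hf.symm)

theorem exists_of_ends {a b : ℤ} (h1 : 0 ≤ a) (h2 : a + 2 ≤ b) (h3 : b < N)
    (h4 : b + 2 ≤ a + N) :
    ∃ e : {e : Sym2 (Fin N) // IsDiagonal e}, lowerEnd e = a ∧ upperEnd e = b := by
  lift a to ℕ using h1
  lift b to ℕ using by omega
  obtain ⟨e, he⟩ : ∃ e : {e : Sym2 (Fin N) // IsDiagonal e},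
      e.1 = s(⟨a, by omega⟩, ⟨b, by omega⟩) :=
    ⟨⟨_, ⟨a, by omega⟩, ⟨b, by omega⟩, rfl, by simp only; omega, by simp only; omega⟩, rfl⟩
  obtain ⟨c, d, hcd, hc, hd⟩ := exists_ends e
  have hb := ends_bounds e
  refine ⟨e, ?_⟩
  rcases Sym2.eq_iff.1 (he.symm.trans hcd) with ⟨rfl, rfl⟩ | ⟨rfl, rfl⟩
  · exact ⟨hc, hd⟩
  · simp only at hc hd
    omega

theorem crosses_iff_overlap_ends (e f : {e : Sym2 (Fin N) // IsDiagonal e}) :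
    Crosses e.1 f.1 ↔ Overlap (lowerEnd e) (upperEnd e) (lowerEnd f) (upperEnd f) := by
  obtain ⟨a, b, he, ha, hb⟩ := exists_ends e
  obtain ⟨c, d, hf, hc, hd⟩ := exists_ends f
  have h1 := ends_bounds e
  have h2 := ends_bounds f
  rw [he, hf, crosses_mk_iff]
  simp only [Fin.lt_def]
  unfold Overlap
  omega

end PolygonDiagonal

namespace CentralDiagonal

variable {n : ℕ} [NeZero n]

theorem nonCrossing_pairOf_pairOf_of_le {i a b c d : ℤ} (ha : 0 ≤ a) (hb : b ≤ n) (hc : 0 ≤ c)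
    (hd : d ≤ n) (h : i + a + 2 ≤ i + b ∧ i + b ≤ i + a + n)
    (h' : i + c + 2 ≤ i + d ∧ i + d ≤ i + c + n) :
    (pairOf (i + a) (i + b) h).NonCrossing (pairOf (i + c) (i + d) h') ↔ ¬ Overlap a b c d := by
  rw [nonCrossing_pairOf_pairOf]
  unfold Overlap
  constructor
  · intro hN hO
    exact hN 0 (by rw [mul_zero]; omega)
  · intro hO t ht
    obtain rfl : t = 0 := Int.eq_zero_of_mul_lt (n := n) (by omega) (by omega)
    rw [mul_zero] at ht
    omega

theorem pairOf_eq_pairOf_of_le {i a b c d : ℤ} (ha : 0 ≤ a) (hb : b ≤ n) (hc : 0 ≤ c)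
    (hd : d ≤ n) {h : i + a + 2 ≤ i + b ∧ i + b ≤ i + a + n}
    {h' : i + c + 2 ≤ i + d ∧ i + d ≤ i + c + n}
    (heq : pairOf (i + a) (i + b) h = pairOf (i + c) (i + d) h') : a = c ∧ b = d := by
  obtain ⟨t, h1, h2⟩ := pairOf_eq_pairOf_iff.1 heq
  obtain rfl : t = 0 := Int.eq_zero_of_mul_lt (n := n) (by omega) (by omega)
  rw [mul_zero] at h1 h2
  omega

section Diameter

/-- The diagonals of an `n + 2`-gon, seen as diagonals that are compatible with the single
diameter through the vertex `i`: the vertices `0, …, n` are the consecutive vertices from `i` to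
its antipode, and the vertex `n + 1` is the central vertex. -/
noncomputable def ofDiameterLink (i : ℤ)
    (e : {e : Sym2 (Fin (n + 1 + 1)) // IsDiagonal e}) : CentralDiagonal n :=
  if h : upperEnd e ≤ n then
    pairOf (i + lowerEnd e) (i + upperEnd e) (by have := ends_bounds e; omega)
  else diameterOf (i + lowerEnd e)

/-- The strict bounds on the lower end hold because the chords from the central vertex `n + 1` to
`0` and to `n` are sides. The chord from `0` to `n` is a diagonal and becomes the pair of bent
diameters. -/
theorem ofDiameterLink_cases (i : ℤ) (e : {e : Sym2 (Fin (n + 1 + 1)) // IsDiagonal e}) :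
    (upperEnd e ≤ n ∧ ∃ h, ofDiameterLink i e = pairOf (i + lowerEnd e) (i + upperEnd e) h) ∨
      (upperEnd e = n + 1 ∧ 0 < lowerEnd e ∧ lowerEnd e < n ∧
        ofDiameterLink i e = diameterOf (i + lowerEnd e)) := by
  have hb := ends_bounds e
  push_cast at hb
  by_cases h : upperEnd e ≤ n
  · exact Or.inl ⟨h, _, dif_pos h⟩
  · exact Or.inr ⟨by omega, by omega, by omega, dif_neg h⟩

theorem ofDiameterLink_injective (i : ℤ) : Function.Injective (ofDiameterLink (n := n) i) := by
  intro e f hef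
  have he := ends_bounds e
  have hf := ends_bounds f
  rcases ofDiameterLink_cases i e with ⟨h1, h2, h3⟩ | ⟨h1, h2, h3, h4⟩ <;>
    rcases ofDiameterLink_cases i f with ⟨k1, k2, k3⟩ | ⟨k1, k2, k3, k4⟩
  · rw [h3, k3] at hef
    obtain ⟨h, h'⟩ := pairOf_eq_pairOf_of_le he.1 h1 hf.1 k1 hef
    exact eq_of_ends_eq h h'
  · exact absurd (h3.symm.trans (hef.trans k4)) (pairOf_ne_diameterOf h2)
  · exact absurd (k3.symm.trans (hef.symm.trans h4)) (pairOf_ne_diameterOf k2)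
  · rw [h4, k4, diameterOf_eq_diameterOf_iff] at hef
    obtain ⟨t, ht⟩ := hef
    obtain rfl : t = 0 := Int.eq_zero_of_mul_lt (n := n) (by omega) (by omega)
    exact eq_of_ends_eq (by omega) (by omega)

theorem nonCrossing_ofDiameterLink (i : ℤ)
    (e f : {e : Sym2 (Fin (n + 1 + 1)) // IsDiagonal e}) :
    ¬ Crosses e.1 f.1 ↔ (ofDiameterLink i e).NonCrossing (ofDiameterLink i f) := by
  rw [crosses_iff_overlap_ends]
  have he := ends_bounds e
  have hf := ends_bounds f
  rcases ofDiameterLink_cases i e with ⟨h1, h2, h3⟩ | ⟨h1, h2, h3, h4⟩ <;>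
    rcases ofDiameterLink_cases i f with ⟨k1, k2, k3⟩ | ⟨k1, k2, k3, k4⟩
  · rw [h3, k3, nonCrossing_pairOf_pairOf_of_le he.1 h1 hf.1 k1]
  · rw [h3, k4, nonCrossing_pairOf_diameterOf]
    unfold Overlap
    constructor
    · intro h t ht
      obtain rfl : t = 0 := Int.eq_zero_of_mul_lt (n := n) (by omega) (by omega)
      rw [mul_zero] at ht
      omega
    · intro h ht
      exact h 0 (by rw [mul_zero]; omega)
  · rw [k3, h4, nonCrossing_diameterOf_pairOf]
    unfold Overlap
    constructor
    · intro h t ht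
      obtain rfl : t = 0 := Int.eq_zero_of_mul_lt (n := n) (by omega) (by omega)
      rw [mul_zero] at ht
      omega
    · intro h ht
      exact h 0 (by rw [mul_zero]; omega)
  · rw [h4, k4]
    -- Both chords end at the central vertex, so they do not overlap, just as single diameters never
    -- cross.
    refine iff_of_true ?_ trivial
    unfold Overlap
    omega

theorem mem_range_ofDiameterLink (i : ℤ) (x : CentralDiagonal n) :
    x ∈ Set.range (ofDiameterLink (n := n) i) ↔
      x ≠ diameterOf i ∧ (diameterOf i).NonCrossing x := by
  constructor
  · rintro ⟨e, rfl⟩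
    have he := ends_bounds e
    rcases ofDiameterLink_cases i e with ⟨h1, h2, h3⟩ | ⟨h1, h2, h3, h4⟩
    · rw [h3, nonCrossing_diameterOf_pairOf]
      refine ⟨pairOf_ne_diameterOf h2, fun t ht => ?_⟩
      obtain rfl : t = 0 := Int.eq_zero_of_mul_lt (n := n) (by omega) (by omega)
      rw [mul_zero] at ht
      omega
    · rw [h4]
      refine ⟨fun h => ?_, trivial⟩
      obtain ⟨t, ht⟩ := diameterOf_eq_diameterOf_iff.1 h
      obtain rfl : t = 0 := Int.eq_zero_of_mul_lt (n := n) (by omega) (by omega)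
      omega
  · rintro ⟨hne, hnc⟩
    rcases eq_circle_or_pairOf_or_diameterOf x i with rfl | ⟨a, b, h, hi, hi', rfl⟩ |
      ⟨j, hi, hi', rfl⟩
    · exact hnc.elim
    · have h1 := (nonCrossing_diameterOf_pairOf h).1 hnc 1
      rw [mul_one] at h1
      obtain ⟨e, he, he'⟩ := exists_of_ends (N := n + 1 + 1) (a := a - i) (b := b - i) (by omega)
        (by omega) (by push_cast; omega) (by push_cast; omega)
      refine ⟨e, ?_⟩
      rcases ofDiameterLink_cases i e with ⟨h1, h2, h3⟩ | ⟨h1, h2, h3, h4⟩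
      · rw [h3]
        congr 1 <;> omega
      · omega
    · have hji : j ≠ i := fun h => hne (by rw [h])
      obtain ⟨e, he, he'⟩ := exists_of_ends (N := n + 1 + 1) (a := j - i) (b := n + 1) (by omega)
        (by omega) (by push_cast; omega) (by push_cast; omega)
      refine ⟨e, ?_⟩
      rcases ofDiameterLink_cases i e with ⟨h1, h2, h3⟩ | ⟨h1, h2, h3, h4⟩
      · omega
      · rw [h4, he]
        congr 1
        omega

end Diameter

/-! ### A minimal diagonalization of known size. -/

section Diameters

variable (n) in
/-- The diagonalization that consists of all single diameters. -/
def allDiameters : Diagonalizations (CentralDiagonal.NonCrossing (n := n)) :=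
  Diagonalizations.mk _ (Set.range fun j : Fin n => diameterOf ((j : ℕ) : ℤ)) (by
    rintro _ ⟨i, rfl⟩ _ ⟨j, rfl⟩ -
    trivial)

theorem diameterOf_mem_allDiameters (j : ℤ) : diameterOf j ∈ (allDiameters n).diagonals := by
  obtain ⟨t, h1, h2⟩ := exists_mem_Ico_add 0 j (natCast_pos_of_neZero n)
  refine ⟨⟨(j + n * t).toNat, by omega⟩, ?_⟩
  rw [diameterOf_add j t]
  simp only
  rw [Int.toNat_of_nonneg h1]

theorem diameterOf_fin_injective :
    Function.Injective fun j : Fin n => diameterOf (n := n) ((j : ℕ) : ℤ) := by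
  intro i j h
  obtain ⟨t, ht⟩ := diameterOf_eq_diameterOf_iff.1 h
  obtain rfl : t = 0 := Int.eq_zero_of_mul_lt (n := n) (by omega) (by omega)
  exact Fin.ext (by omega)

theorem ncard_allDiameters : (allDiameters n).diagonals.ncard = n := by
  change (Set.range fun j : Fin n => diameterOf (n := n) ((j : ℕ) : ℤ)).ncard = n
  rw [← Set.image_univ, Set.ncard_image_of_injective _ diameterOf_fin_injective, Set.ncard_univ, Nat.card_fin]

/-- Nothing can be added: the circle crosses every diameter, and a pair crosses the diameter at any
vertex it cuts off, such as `a + 1`. -/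
theorem isMin_allDiameters : IsMin (allDiameters n) := by
  intro V hV x hx
  rcases eq_circle_or_pairOf_or_diameterOf x 0 with rfl | ⟨a, b, h, -, -, rfl⟩ | ⟨j, -, -, rfl⟩
  · exact (V.pairwise hx (hV (diameterOf_mem_allDiameters 0)) diameterOf_ne_circle.symm).elim
  · have := V.pairwise hx (hV (diameterOf_mem_allDiameters (a + 1))) (pairOf_ne_diameterOf h)
    refine ((nonCrossing_pairOf_diameterOf h).1 this 0 ?_).elim
    rw [mul_zero]
    omega
  · exact diameterOf_mem_allDiameters j

end Diameters

end CentralDiagonal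

/-! ### Diagonals that are compatible with a pair -/

/-- The strictly increasing map `ℤ → ℤ` that sends `0, …, k - 1` to consecutive integers from `a`
on and intertwines translation by `k` with translation by `n`. -/
def spread (n k : ℕ) (a x : ℤ) : ℤ := a + x % k + n * (x / k)

section Spread

variable {n k : ℕ} {a : ℤ}

theorem spread_of_lt {x : ℤ} (h0 : 0 ≤ x) (h : x < k) : spread n k a x = a + x := by
  rw [spread, Int.emod_eq_of_lt h0 h, Int.ediv_eq_zero_of_lt h0 h, mul_zero, add_zero]

variable [NeZero k]

theorem spread_add (x t : ℤ) : spread n k a (x + k * t) = spread n k a x + n * t := by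
  have hk := natCast_pos_of_neZero k
  rw [spread, spread, Int.add_mul_emod_self_left, Int.add_mul_ediv_left _ _ hk.ne']
  ring

theorem exists_eq_add_mul (x : ℤ) : ∃ r q : ℤ, 0 ≤ r ∧ r < k ∧ x = r + k * q :=
  have hk := natCast_pos_of_neZero k
  ⟨x % k, x / k, Int.emod_nonneg x hk.ne', Int.emod_lt_of_pos x hk,
    (Int.emod_add_mul_ediv x k).symm⟩

theorem spread_strictMono (h : k ≤ n) : StrictMono (spread n k a) := by
  have hk := natCast_pos_of_neZero k
  refine strictMono_int_of_lt_succ fun x => ?_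
  obtain ⟨r, q, h0, hr, rfl⟩ := exists_eq_add_mul (k := k) x
  rw [spread_add, spread_of_lt h0 hr]
  rcases lt_or_ge (r + 1) k with h1 | h1
  · rw [show r + k * q + 1 = r + 1 + k * q by ring, spread_add, spread_of_lt (by omega) h1]
    omega
  · obtain rfl : r = k - 1 := by omega
    rw [show (k - 1 + k * q + 1 : ℤ) = 0 + k * (q + 1) by ring, spread_add,
      spread_of_lt le_rfl hk]
    have : (k : ℤ) ≤ n := by exact_mod_cast h
    linarith

theorem spread_width (h : k ≤ n) {x y : ℤ} (hxy : x + 2 ≤ y ∧ y ≤ x + k) :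
    spread n k a x + 2 ≤ spread n k a y ∧ spread n k a y ≤ spread n k a x + n := by
  have hm := spread_strictMono (a := a) h
  have h1 := hm (show x < x + 1 by omega)
  have h2 := hm (show x + 1 < y by omega)
  have h3 := hm.monotone (show y ≤ x + k * 1 by omega)
  rw [spread_add, mul_one] at h3
  omega

theorem overlap_spread (h : k ≤ n) {x y z w : ℤ} :
    Overlap (spread n k a x) (spread n k a y) (spread n k a z) (spread n k a w) ↔
      Overlap x y z w := by
  unfold Overlap
  simp only [(spread_strictMono (a := a) h).lt_iff_lt]

end Spread

namespace CentralDiagonal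

section Pair

variable {n m k : ℕ} [NeZero n] [NeZero k]

/-- The map `spread` avoids the vertices strictly between `i` and `i + m`. -/
theorem spread_avoids (hmk : m + k = n + 1) (i x t : ℤ) :
    ¬ (i < spread n k (i + m) x + n * t ∧ spread n k (i + m) x + n * t < i + m) := by
  obtain ⟨r, q, h0, hr, rfl⟩ := exists_eq_add_mul (k := k) x
  rw [spread_add, spread_of_lt h0 hr, add_assoc, ← mul_add]
  generalize q + t = s
  rintro ⟨h1, h2⟩
  -- For `s ≥ 0` the value is at least `i + m`; for `s < 0` it is at most `i + m + (k - 1) - n = i`.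
  have h3 : s < 0 := by
    have : (n : ℤ) * s < 0 := by omega
    have hn := natCast_pos_of_neZero n
    nlinarith
  have h4 : (n : ℤ) * s ≤ -n := by nlinarith
  omega

/-- The diagonals of an `m + 1`-gon, seen as diagonals of the polygon that the pair with ends `i`
and `i + m` cuts off. -/
noncomputable def ofCutOff (hm : m ≤ n) (i : ℤ)
    (e : {e : Sym2 (Fin (m + 1)) // IsDiagonal e}) : CentralDiagonal n :=
  pairOf (i + lowerEnd e) (i + upperEnd e) (by have := ends_bounds e; omega)

/-- The diagonals of the `2k`-gon with a central vertex, seen as diagonals of the polygon that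
remains after cutting off the two `m + 1`-gons of the pair with ends `i` and `i + m`. -/
noncomputable def ofRemaining (hk : k ≤ n) (a : ℤ) : CentralDiagonal k → CentralDiagonal n
  | .circle => .circle
  | .pair D => pairOf (spread n k a (exists_eq_pairOf D).choose.1.1)
      (spread n k a (exists_eq_pairOf D).choose.1.2) (spread_width hk (exists_eq_pairOf D).choose.2)
  | .diameter e => diameterOf (spread n k a (exists_eq_diameterOf e).choose)

/-- The chosen labels differ from `x` and `y` by a common multiple of `k`, which `spread` turns into
a multiple of `n`; so the choice does not matter. -/
theorem ofRemaining_pairOf (hk : k ≤ n) (a : ℤ) {x y : ℤ} (h : x + 2 ≤ y ∧ y ≤ x + k) :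
    ofRemaining hk a (pairOf x y h) =
      pairOf (spread n k a x) (spread n k a y) (spread_width hk h) := by
  generalize hD : pairOf x y h = z
  rcases z with _ | D | e
  · cases hD
  · rw [ofRemaining, pairOf_eq_pairOf_iff]
    have h1 := hD.trans (exists_eq_pairOf D).choose_spec
    rw [pairOf_eq_pairOf_iff] at h1
    obtain ⟨t, h2, h3⟩ := h1
    exact ⟨-t, by rw [h2, spread_add]; ring, by rw [h3, spread_add]; ring⟩
  · cases hD

theorem ofRemaining_diameterOf (hk : k ≤ n) (a x : ℤ) :
    ofRemaining hk a (diameterOf x) = diameterOf (spread n k a x) := by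
  generalize hD : diameterOf (n := k) x = z
  rcases z with _ | D | e
  · cases hD
  · cases hD
  · rw [ofRemaining, diameterOf_eq_diameterOf_iff]
    have h1 := hD.trans (exists_eq_diameterOf e).choose_spec
    rw [diameterOf_eq_diameterOf_iff] at h1
    obtain ⟨t, h2⟩ := h1
    exact ⟨-t, by rw [h2, spread_add]; ring⟩

theorem ofRemaining_cases (hk : k ≤ n) (a : ℤ) (x : CentralDiagonal k) :
    (x = circle ∧ ofRemaining hk a x = circle) ∨
      (∃ b c h h', x = pairOf b c h ∧
        ofRemaining hk a x = pairOf (spread n k a b) (spread n k a c) h') ∨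
      ∃ j, x = diameterOf j ∧ ofRemaining hk a x = diameterOf (spread n k a j) := by
  rcases eq_circle_or_pairOf_or_diameterOf x 0 with rfl | ⟨b, c, h, -, -, rfl⟩ | ⟨j, -, -, rfl⟩
  · exact Or.inl ⟨rfl, rfl⟩
  · exact Or.inr (Or.inl ⟨b, c, h, _, rfl, ofRemaining_pairOf hk a h⟩)
  · exact Or.inr (Or.inr ⟨j, rfl, ofRemaining_diameterOf hk a j⟩)

theorem ofCutOff_injective (hm : m ≤ n) (i : ℤ) : Function.Injective (ofCutOff hm i) := by
  intro e f hef
  have he := ends_bounds e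
  have hf := ends_bounds f
  obtain ⟨h, h'⟩ := pairOf_eq_pairOf_of_le he.1 (by omega) hf.1 (by omega) hef
  exact eq_of_ends_eq h h'

theorem ofRemaining_injective (hk : k ≤ n) (a : ℤ) : Function.Injective (ofRemaining hk a) := by
  have hinj := (spread_strictMono (a := a) hk).injective
  intro x y hxy
  rcases ofRemaining_cases hk a x with ⟨rfl, hx⟩ | ⟨b, c, h, h', rfl, hx⟩ | ⟨j, rfl, hx⟩ <;>
    rcases ofRemaining_cases hk a y with ⟨rfl, hy⟩ | ⟨b', c', g, g', rfl, hy⟩ | ⟨j', rfl, hy⟩ <;>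
    have hxy' := hx.symm.trans (hxy.trans hy)
  · rfl
  · cases hxy'
  · cases hxy'
  · cases hxy'
  · rw [pairOf_eq_pairOf_iff] at hxy' ⊢
    obtain ⟨t, h1, h2⟩ := hxy'
    exact ⟨t, hinj (by rw [h1, spread_add]), hinj (by rw [h2, spread_add])⟩
  · cases hxy'
  · cases hxy'
  · cases hxy'
  · rw [diameterOf_eq_diameterOf_iff] at hxy' ⊢
    obtain ⟨t, h1⟩ := hxy'
    exact ⟨t, hinj (by rw [h1, spread_add])⟩

/-- A diagonal of the cut-off polygon has an end strictly between `i` and `i + m`, where `spread`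
takes no value even modulo `n`. -/
theorem ofCutOff_ne_ofRemaining (hm : m ≤ n) (hk : k ≤ n) (hmk : m + k = n + 1) (i : ℤ)
    (e : {e : Sym2 (Fin (m + 1)) // IsDiagonal e}) (x : CentralDiagonal k) :
    ofCutOff hm i e ≠ ofRemaining hk (i + m) x := by
  intro h
  have he := ends_bounds e
  rcases ofRemaining_cases hk (i + m) x with ⟨rfl, hx⟩ | ⟨b, c, h, h', rfl, hx⟩ | ⟨j, rfl, hx⟩
  · exact pairOf_ne_circle _ (h.trans hx)
  · rw [hx, ofCutOff, pairOf_eq_pairOf_iff] at h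
    obtain ⟨t, h1, h2⟩ := h
    have h3 := spread_avoids hmk i b (-t)
    have h4 := spread_avoids hmk i c (-t)
    rw [h1, mul_neg] at h3
    rw [h2, mul_neg] at h4
    push_cast at he
    omega
  · exact pairOf_ne_diameterOf _ (h.trans hx)

theorem nonCrossing_ofCutOff (hm : m ≤ n) (i : ℤ)
    (e f : {e : Sym2 (Fin (m + 1)) // IsDiagonal e}) :
    ¬ Crosses e.1 f.1 ↔ (ofCutOff hm i e).NonCrossing (ofCutOff hm i f) := by
  have he := ends_bounds e
  have hf := ends_bounds f
  rw [crosses_iff_overlap_ends, ofCutOff, ofCutOff,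
    nonCrossing_pairOf_pairOf_of_le he.1 (by omega) hf.1 (by omega)]

theorem nonCrossing_ofRemaining (hk : k ≤ n) (a : ℤ) (x y : CentralDiagonal k) :
    x.NonCrossing y ↔ (ofRemaining hk a x).NonCrossing (ofRemaining hk a y) := by
  have hlt : ∀ x y : ℤ, spread n k a x < spread n k a y ↔ x < y := fun x y =>
    (spread_strictMono (a := a) hk).lt_iff_lt
  rcases ofRemaining_cases hk a x with ⟨rfl, hx⟩ | ⟨b, c, h, h', rfl, hx⟩ | ⟨j, rfl, hx⟩ <;>
    rcases ofRemaining_cases hk a y with ⟨rfl, hy⟩ | ⟨b', c', g, g', rfl, hy⟩ | ⟨j', rfl, hy⟩ <;>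
    rw [hx] <;> try rw [hy]
  · exact Iff.rfl
  · exact Iff.rfl
  · exact Iff.rfl
  · exact Iff.rfl
  · simp only [nonCrossing_pairOf_pairOf, ← spread_add, overlap_spread hk]
  · simp only [nonCrossing_pairOf_diameterOf, ← spread_add, hlt]
  · exact Iff.rfl
  · simp only [nonCrossing_diameterOf_pairOf, ← spread_add, hlt]
  · exact Iff.rfl

/-- A crossing would put an end of the remaining chord strictly inside the cut-off arc, against
`spread_avoids`. -/
theorem nonCrossing_ofCutOff_ofRemaining (hm : m ≤ n) (hk : k ≤ n) (hmk : m + k = n + 1) (i : ℤ)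
    (e : {e : Sym2 (Fin (m + 1)) // IsDiagonal e}) (x : CentralDiagonal k) :
    (ofCutOff hm i e).NonCrossing (ofRemaining hk (i + m) x) := by
  have he := ends_bounds e
  push_cast at he
  rcases ofRemaining_cases hk (i + m) x with ⟨rfl, hx⟩ | ⟨b, c, h, h', rfl, hx⟩ | ⟨j, rfl, hx⟩ <;>
    rw [hx]
  · trivial
  · rw [ofCutOff, nonCrossing_pairOf_pairOf]
    intro t ht
    have h3 := spread_avoids hmk i b t
    have h4 := spread_avoids hmk i c t
    unfold Overlap at ht
    omega
  · rw [ofCutOff, nonCrossing_pairOf_diameterOf]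
    intro t ht
    have h3 := spread_avoids hmk i j t
    omega

theorem mem_range_pairLink (hm : m ≤ n) (hk : k ≤ n) (hmk : m + k = n + 1) (i : ℤ)
    (hp : i + 2 ≤ i + m ∧ i + m ≤ i + n) (x : CentralDiagonal n) :
    x ∈ Set.range (Sum.elim (ofCutOff hm i) (ofRemaining hk (i + m))) ↔
      x ≠ pairOf i (i + m) hp ∧ (pairOf i (i + m) hp).NonCrossing x := by
  have hn := natCast_pos_of_neZero n
  have hkpos := natCast_pos_of_neZero k
  constructor
  · rintro ⟨e | y, rfl⟩
    · have he := ends_bounds e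
      push_cast at he
      constructor
      · intro h
        rw [Sum.elim_inl, ofCutOff, pairOf_eq_pairOf_iff] at h
        obtain ⟨t, h1, h2⟩ := h
        omega
      · rw [Sum.elim_inl, ofCutOff, nonCrossing_pairOf_pairOf]
        intro t ht
        unfold Overlap at ht
        obtain rfl : t = 0 := Int.eq_zero_of_mul_lt (n := n) (by omega) (by omega)
        rw [mul_zero] at ht
        omega
    · rcases ofRemaining_cases hk (i + m) y with ⟨rfl, hx⟩ | ⟨b, c, h, h', rfl, hx⟩ |
        ⟨j, rfl, hx⟩ <;> rw [Sum.elim_inr, hx]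
      · exact ⟨(pairOf_ne_circle _).symm, trivial⟩
      · constructor
        · intro heq
          obtain ⟨t, h1, h2⟩ := pairOf_eq_pairOf_iff.1 heq
          have hs := spread_strictMono (a := i + m) hk
          have h3 := hs (show b < b + 1 by omega)
          have h4 := hs (show b + 1 < c by omega)
          refine spread_avoids hmk i (b + 1) t ?_
          omega
        · rw [nonCrossing_pairOf_pairOf]
          intro t ht
          have h3 := spread_avoids hmk i b t
          have h4 := spread_avoids hmk i c t
          unfold Overlap at ht
          omega
      · refine ⟨(pairOf_ne_diameterOf _).symm, ?_⟩
        rw [nonCrossing_pairOf_diameterOf]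
        exact spread_avoids hmk i j
  · rintro ⟨hne, hnc⟩
    rcases eq_circle_or_pairOf_or_diameterOf x i with rfl | ⟨a, b, h, hi, hi', rfl⟩ |
      ⟨j, hi, hi', rfl⟩
    · exact ⟨Sum.inr circle, rfl⟩
    · rw [nonCrossing_pairOf_pairOf] at hnc
      have h0 := hnc 0
      have h1 := hnc (-1)
      rw [mul_zero, add_zero, add_zero] at h0
      rw [mul_neg_one] at h1
      unfold Overlap at h0 h1
      have key : ∀ x y t : ℤ, ∀ hxy : x + 2 ≤ y ∧ y ≤ x + k,
          spread n k (i + m) x = a + n * t → spread n k (i + m) y = b + n * t →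
          pairOf a b h ∈ Set.range (Sum.elim (ofCutOff hm i) (ofRemaining hk (i + m))) := by
        intro x y t hxy h1 h2
        refine ⟨Sum.inr (pairOf x y hxy), ?_⟩
        rw [Sum.elim_inr, ofRemaining_pairOf, eq_comm, pairOf_eq_pairOf_iff]
        exact ⟨t, h1, h2⟩
      have hfar : ∀ y : ℤ, 0 ≤ y → y < k → spread n k (i + m) (y + k * 1) = i + m + y + n := by
        intro y h1 h2
        rw [spread_add, spread_of_lt h1 h2, mul_one]
      by_cases hbm : b ≤ i + m
      · have hab : ¬ (a = i ∧ b = i + m) := by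
          rintro ⟨rfl, rfl⟩
          exact hne rfl
        obtain ⟨e, he, he'⟩ := exists_of_ends (N := m + 1) (a := a - i) (b := b - i) (by omega)
          (by omega) (by push_cast; omega) (by push_cast; omega)
        refine ⟨Sum.inl e, ?_⟩
        rw [Sum.elim_inl, ofCutOff]
        congr 1 <;> omega
      -- Now both ends avoid the open arc from `i` to `i + m` modulo `n`. If `a = i`, it is read as
      -- `i + n`, the image of `k - 1`, and so both labels shift by `n`.
      · rcases hi.eq_or_lt with rfl | hia
        · refine key (k - 1) (b - i - m + k * 1) 1 ⟨by omega, by omega⟩ ?_ ?_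
          · rw [spread_of_lt (by omega) (by omega)]
            omega
          · rw [hfar _ (by omega) (by omega)]
            omega
        · by_cases hbn : b ≤ i + n
          · refine key (a - i - m) (b - i - m) 0 ⟨by omega, by omega⟩ ?_ ?_
            · rw [spread_of_lt (by omega) (by omega)]
              omega
            · rw [spread_of_lt (by omega) (by omega)]
              omega
          -- The chord passes `i + n`, so by `h1` it also passes the next cut-off arc; its upper end
          -- lies in the second block of `spread`.
          · refine key (a - i - m) (b - n - i - m + k * 1) 0 ⟨by omega, by omega⟩ ?_ ?_
            · rw [spread_of_lt (by omega) (by omega)]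
              omega
            · rw [hfar _ (by omega) (by omega)]
              omega
    · rw [nonCrossing_pairOf_diameterOf] at hnc
      have h0 := hnc 0
      rw [mul_zero, add_zero] at h0
      rcases hi.eq_or_lt with rfl | hij
      -- Vertex `i` is antipodal to `i + n`, the image of `k - 1`.
      · refine ⟨Sum.inr (diameterOf (k - 1)), ?_⟩
        rw [Sum.elim_inr, ofRemaining_diameterOf, spread_of_lt (by omega) (by omega), eq_comm,
          diameterOf_eq_diameterOf_iff]
        exact ⟨1, by omega⟩
      · refine ⟨Sum.inr (diameterOf (j - i - m)), ?_⟩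
        rw [Sum.elim_inr, ofRemaining_diameterOf, spread_of_lt (by omega) (by omega)]
        congr 1
        omega

end Pair

/-! ### Enumeration of the diagonals. -/

section Index

variable {n : ℕ} [NeZero n]

/-- The diagonals of the polygon with a central vertex, by type: the circle, the single diameters,
and for each `m` the pairs that cut off `m` sides. -/
def ofIndex : Unit ⊕ Fin n ⊕ (Finset.Icc 2 n × Fin n) → CentralDiagonal n
  | .inl _ => circle
  | .inr (.inl i) => diameterOf ((i : ℕ) : ℤ)
  | .inr (.inr p) => pairOf ((p.2 : ℕ) : ℤ) ((p.2 : ℕ) + (p.1 : ℕ)) (by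
      have := Finset.mem_Icc.1 p.1.2
      omega)

/-- Each orbit of labels under translation by `n` has exactly one representative that starts in `[0,
n)`, and translation preserves the width. -/
theorem ofIndex_bijective : Function.Bijective (ofIndex (n := n)) := by
  constructor
  · rintro (_ | i | ⟨m, i⟩) (_ | j | ⟨m', j⟩) h
    · rfl
    · cases h
    · cases h
    · cases h
    · rw [diameterOf_fin_injective h]
    · cases h
    · cases h
    · cases h
    · rw [ofIndex, ofIndex, pairOf_eq_pairOf_iff] at h
      obtain ⟨t, h1, h2⟩ := h
      simp only at h1 h2
      obtain rfl : t = 0 := Int.eq_zero_of_mul_lt (n := n) (by omega) (by omega)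
      rw [mul_zero] at h1 h2
      obtain rfl : i = j := Fin.ext (by omega)
      obtain rfl : m = m' := Subtype.ext (by omega)
      rfl
  · intro x
    rcases eq_circle_or_pairOf_or_diameterOf x 0 with rfl | ⟨a, b, h, h1, h2, rfl⟩ |
      ⟨j, h1, h2, rfl⟩
    · exact ⟨Sum.inl (), rfl⟩
    · lift a to ℕ using h1
      lift b to ℕ using by omega
      refine ⟨Sum.inr (Sum.inr (⟨b - a, Finset.mem_Icc.2 ⟨by omega, by omega⟩⟩,
        ⟨a, by omega⟩)), ?_⟩
      rw [ofIndex]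
      congr 1
      simp only
      omega
    · lift j to ℕ using h1
      exact ⟨Sum.inr (Sum.inl ⟨j, by omega⟩), rfl⟩

end Index

end CentralDiagonal

/-! ### The facets of the halohedron. -/

open CentralDiagonal Diagonalizations

/-- The facets of a halohedron `H_n` are indexed, bijectively, by a disjoint union of three sets:
one facet that is a cyclohedron `W_n`; `n` facets that are associahedra `K_{n+1}`; and, for each
`m ∈ {2, …, n}`, `n` facets (hence `n ^ 2 - n` in total) that are combinatorially products of an
associahedron `K_m` and a halohedron `H_{n-m+1}`. -/
theorem proposition16 {E : Type*} [NormedAddCommGroup E] [NormedSpace ℝ E] [FiniteDimensional ℝ E]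
    (n : ℕ) (hn : 1 ≤ n) (P : Set E) (hP : IsHalohedron n P) :
    Nat.card (Finset.Icc 2 n × Fin n) = n ^ 2 - n ∧
    ∃ facet : Unit ⊕ Fin n ⊕ (Finset.Icc 2 n × Fin n) ≃ Facet P,
      IsCyclohedron n (facet (Sum.inl ())).1 ∧
      (∀ i : Fin n, IsAssociahedron (n + 1) (facet (Sum.inr (Sum.inl i))).1) ∧
      (∀ (m : Finset.Icc 2 n) (j : Fin n),
        ∃ A B : Set E, IsAssociahedron (m : ℕ) A ∧ IsHalohedron (n - (m : ℕ) + 1) B ∧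
          CombEquiv (facet (Sum.inr (Sum.inr (m, j)))).1 (A ×ˢ B)) := by
  have : NeZero n := ⟨by omega⟩
  obtain ⟨hpoly, hdim, ⟨Φ⟩⟩ := hP
  refine ⟨?_, ?_⟩
  · rw [Nat.card_eq_fintype_card, Fintype.card_prod, Fintype.card_coe, Nat.card_Icc,
      Fintype.card_fin, sq]
    obtain ⟨q, rfl⟩ : ∃ q, n = q + 1 := ⟨n - 1, by omega⟩
    rw [show q + 1 + 1 - 2 = q by omega]
    exact (Nat.sub_eq_of_eq_add (by ring)).symm
  obtain ⟨e, he⟩ := hpoly.exists_facetEquiv Φ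
  refine ⟨(Equiv.ofBijective _ ofIndex_bijective).trans e, ?_, fun i => ?_, fun m j => ?_⟩
  · have hF := (e circle).2
    refine ⟨hpoly.of_isExposed hF.1 hF.2.1, hF.2.2.trans hdim, ?_⟩
    change Nonempty (Face (e circle).1 ≃o PosetB n)
    rw [he]
    -- The diagonals compatible with the circle and different from it are exactly the pairs, with
    -- the same crossing relation as in `PosetB n`.
    refine hpoly.nonempty_face_single_iso Φ nonCrossing_symm (f := CentralDiagonal.pair)
      (fun D D' h => by cases h; rfl) (fun x => ?_) fun D D' => Iff.rfl
    rcases x with _ | D | d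
    · refine iff_of_false ?_ fun h => h.1 rfl
      rintro ⟨D, hD⟩
      cases hD
    · exact iff_of_true ⟨D, rfl⟩ ⟨fun h => (by cases h), trivial⟩
    · refine iff_of_false ?_ fun h => h.2
      rintro ⟨D, hD⟩
      cases hD
  · have hF := (e (diameterOf ((i : ℕ) : ℤ))).2
    refine ⟨hpoly.of_isExposed hF.1 hF.2.1, ?_, ?_⟩
    · change polyDim (e (diameterOf ((i : ℕ) : ℤ))).1 + 2 = n + 1
      omega
    · change Nonempty (Face (e (diameterOf ((i : ℕ) : ℤ))).1 ≃o PosetA (n + 1 + 1))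
      rw [he]
      exact hpoly.nonempty_face_single_iso Φ nonCrossing_symm (ofDiameterLink_injective _)
        (mem_range_ofDiameterLink _) (nonCrossing_ofDiameterLink _)
  · obtain ⟨m, hm⟩ := m
    have hm' := Finset.mem_Icc.1 hm
    have : NeZero (n - m + 1) := ⟨by omega⟩
    have hk : n - m + 1 ≤ n := by omega
    -- Modulo the half turn there are `n` vertices, of which the pair cuts off `m - 1`.
    have hmk : m + (n - m + 1) = n + 1 := by omega
    have hp : ((j : ℕ) : ℤ) + 2 ≤ (j : ℕ) + (m : ℕ) ∧
      ((j : ℕ) : ℤ) + (m : ℕ) ≤ (j : ℕ) + n := by omega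
    obtain ⟨A, B, hA, hB, hA', hB', hAd, hBd, hAB⟩ := hpoly.exists_prod_face_single Φ
      (D := pairOf ((j : ℕ) : ℤ) ((j : ℕ) + (m : ℕ)) hp) nonCrossing_symm
      ((ofCutOff_injective hm'.2 _).sumElim (ofRemaining_injective hk _)
        (ofCutOff_ne_ofRemaining hm'.2 hk hmk _))
      (mem_range_pairLink hm'.2 hk hmk _ hp) (nonCrossing_ofCutOff hm'.2 _)
      (nonCrossing_ofRemaining hk _) (nonCrossing_ofCutOff_ofRemaining hm'.2 hk hmk _)
      isMin_allDiameters
    rw [ncard_allDiameters] at hAd hBd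
    refine ⟨A, B, ⟨hA, by simp only; omega, hA'⟩, ⟨hB, hBd, hB'⟩, ?_⟩
    rw [← he] at hAB
    exact hAB
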